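/- Let $d,m\in\mathbb N$, let $p\in(1,2)$, $p'=p/(p-1)$, $T>0$, and let $\Omega\subset\mathbb R^d$ be a bounded open set; put $\Omega_T=(0,T)\times\Omega$. All functions on $\Omega$ and $\Omega_T$ are $\mathbb R^m$-valued. Let $W^{1,p}_0(\Omega)$ be the closure of $C_c^\infty(\Omega)$ in $W^{1,p}(\Omega)$ and $W^{-1,p'}(\Omega)$ its dual space. Define $$W=\bigl\{u\in L^\infty(\Omega_T)\cap L^p(0,T;W^{1,p}_0(\Omega)) : \partial_t u\in L^p(0,T;L^p(\Omega))+L^{p'}(0,T;W^{-1,p'}(\Omega))\bigr\},$$ where $\partial_t u$ is the distributional time derivative on $\Omega_T$, with the norm $$\|u\|_W=\|u\|_{L^\infty(\Omega_T)}+\|u\|_{L^p(0,T;W^{1,p}_0(\Omega))}+\inf_{\partial_t u=f+g}\bigl(\|f\|_{L^p(0,T;L^p(\Omega))}+\|g\|_{L^{p'}(0,T;W^{-1,p'}(\Omega))}\bigr),$$ the infimum being over $f\in L^p(0,T;L^p(\Omega))$ and $g\in L^{p'}(0,T;W^{-1,p'}(\Omega))$. Then $W$ embeds continuously in $C([0,T];L^2(\Omega))$: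 every $u\in W$ has a representative $Ju\in C([0,T];L^2(\Omega))$, that is, $(Ju)(t)=u(t,\cdot)$ a.e. in $\Omega$ for almost every $t\in(0,T)$; the map $J:W\to C([0,T];L^2(\Omega))$ is linear and injective; and there is a constant $C$, depending only on $d,m,p,T,\Omega$, such that $$\sup_{t\in[0,T]}\|(Ju)(t)\|_{L^2(\Omega)}\le C\,\|u\|_W\qquad\text{for all }u\in W.$$ -/

import Mathlib

open MeasureTheory Set TopologicalSpace
open scoped ENNReal Distributions

noncomputable section

namespace ParabolicW

/-- The Euclidean space `ℝⁿ`. -/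
abbrev Eu (n : ℕ) := EuclideanSpace ℝ (Fin n)

/-- Lebesgue measure on the open set `Ω`. -/
abbrev volOn {d : ℕ} (Ω : Opens (Eu d)) : Measure (Eu d) := volume.restrict (Ω : Set (Eu d))

/-- Lebesgue measure on the time interval `(0,T)`. -/
abbrev volTime (T : ℝ) : Measure ℝ := volume.restrict (Ioo 0 T)

/-- Lebesgue measure on the space-time cylinder `Ω_T = (0,T) × Ω`. -/
abbrev volCyl {d : ℕ} (T : ℝ) (Ω : Opens (Eu d)) : Measure (ℝ × Eu d) :=
  volume.restrict (Ioo 0 T ×ˢ (Ω : Set (Eu d)))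

/-- The time interval `(0,T)` as an open set. -/
def timeOpens (T : ℝ) : Opens ℝ := ⟨Ioo 0 T, isOpen_Ioo⟩

section Sobolev

variable {d : ℕ} {Ω : Opens (Eu d)} {m : ℕ}

lemma hasCompactSupport_fderiv (φ : 𝓓(Ω, Eu m)) : HasCompactSupport (fderiv ℝ φ) :=
  φ.hasCompactSupport.fderiv ℝ

lemma continuous_fderiv (φ : 𝓓(Ω, Eu m)) : Continuous (fderiv ℝ φ) :=
  φ.contDiff.continuous_fderiv (by simp)

lemma memLp_test (p : ℝ≥0∞) (φ : 𝓓(Ω, Eu m)) : MemLp φ p (volOn Ω) :=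
  φ.continuous.memLp_of_hasCompactSupport φ.hasCompactSupport

lemma memLp_fderiv_test (p : ℝ≥0∞) (φ : 𝓓(Ω, Eu m)) : MemLp (fderiv ℝ φ) p (volOn Ω) :=
  (continuous_fderiv φ).memLp_of_hasCompactSupport (hasCompactSupport_fderiv φ)

variable (Ω) (m) (p : ℝ≥0∞) [Fact (1 ≤ p)]

/-- Pairs `(v, G)` with `v ∈ L^p(Ω; ℝᵐ)` and `G ∈ L^p(Ω; ℝ^{m×d})`, with the norm
`(‖v‖_p^p + ‖G‖_p^p)^{1/p}`.  Matrices carry the operator norm, which is equivalent to every other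
matrix norm. -/
abbrev LpPair : Type :=
  WithLp p (Lp (Eu m) p (volOn Ω) × Lp (Eu d →L[ℝ] Eu m) p (volOn Ω))

/-- The map `φ ↦ (φ, ∇φ)` on `C_c^∞(Ω; ℝᵐ)`. -/
def testGraph : 𝓓(Ω, Eu m) →ₗ[ℝ] LpPair Ω m p where
  toFun φ := WithLp.toLp p ((memLp_test p φ).toLp _, (memLp_fderiv_test p φ).toLp _)
  map_add' φ ψ := by
    have h : fderiv ℝ (φ + ψ : 𝓓(Ω, Eu m)) = fderiv ℝ φ + fderiv ℝ ψ := by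
      funext x
      exact fderiv_add (φ.contDiff.differentiable (by simp) x) (ψ.contDiff.differentiable (by simp) x)
    rw [← WithLp.toLp_add, Prod.mk_add_mk]
    congr 2
    simp only [h]
    rfl
  map_smul' c φ := by
    have h : fderiv ℝ (c • φ : 𝓓(Ω, Eu m)) = c • fderiv ℝ φ := by
      funext x
      exact fderiv_const_smul (φ.contDiff.differentiable (by simp) x) c
    rw [RingHom.id_apply, ← WithLp.toLp_smul, Prod.smul_mk]
    congr 2
    simp only [h]
    rfl

/-- The closure of `C_c^∞(Ω; ℝᵐ)` in the norm of `W^{1,p}(Ω; ℝᵐ)`, as a space of pairs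
(function, weak gradient). -/
def W01pSubmodule : Submodule ℝ (LpPair Ω m p) :=
  (LinearMap.range (testGraph Ω m p)).topologicalClosure

/-- The Sobolev space `W^{1,p}_0(Ω; ℝᵐ)`: the closure of `C_c^∞(Ω; ℝᵐ)` in the norm of
`W^{1,p}(Ω; ℝᵐ)`.  An element is stored as the pair (function, weak gradient). -/
def W01p : Type := W01pSubmodule Ω m p

instance : NormedAddCommGroup (W01p Ω m p) :=
  inferInstanceAs (NormedAddCommGroup (W01pSubmodule Ω m p))

instance : NormedSpace ℝ (W01p Ω m p) :=
  inferInstanceAs (NormedSpace ℝ (W01pSubmodule Ω m p))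

/-- The dual space `W^{-1,p'}(Ω; ℝᵐ) = (W^{1,p}_0(Ω; ℝᵐ))'`. -/
abbrev Wneg : Type := StrongDual ℝ (W01p Ω m p)

variable {Ω m p}

/-- The function underlying an element of `W^{1,p}_0(Ω; ℝᵐ)`. -/
def W01p.val : W01p Ω m p →ₗ[ℝ] Lp (Eu m) p (volOn Ω) where
  toFun w := (Subtype.val (p := (· ∈ W01pSubmodule Ω m p)) w).fst
  map_add' _ _ := rfl
  map_smul' _ _ := rfl

/-- A test function as an element of `W^{1,p}_0(Ω; ℝᵐ)`. -/
def W01p.ofTest : 𝓓(Ω, Eu m) →ₗ[ℝ] W01p Ω m p :=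
  (testGraph Ω m p).codRestrict (W01pSubmodule Ω m p) fun φ =>
    Submodule.le_topologicalClosure _ (LinearMap.mem_range_self _ φ)

end Sobolev

section Bochner

variable {d : ℕ} {Ω : Opens (Eu d)} {m : ℕ} {p : ℝ≥0∞} [Fact (1 ≤ p)] {T : ℝ}

/-- `U ∈ L^p(0,T; W^{1,p}_0(Ω))` is the function `t ↦ u(t,·)`. -/
def IsSlices (u : Lp (Eu m) ∞ (volCyl T Ω)) (U : Lp (W01p Ω m p) p (volTime T)) : Prop :=
  ∀ᵐ t ∂(volTime T), ∀ᵐ x ∂(volOn Ω), W01p.val (U t) x = u (t, x)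

/-- `∂ₜu = f + g` in the sense of distributions on `(0,T) × Ω`, where
`f ∈ L^p(0,T; L^p(Ω)) = L^p(Ω_T)` and `g ∈ L^{p'}(0,T; W^{-1,p'}(Ω))`.  It is tested with the
functions `η(t) φ(x)`, whose linear span is dense in `C_c^∞((0,T) × Ω; ℝᵐ)`. -/
def HasTimeDeriv (u : Lp (Eu m) ∞ (volCyl T Ω)) (f : Lp (Eu m) p (volCyl T Ω))
    (g : Lp (Wneg Ω m p) p.conjExponent (volTime T)) : Prop :=
  ∀ (η : 𝓓(timeOpens T, ℝ)) (φ : 𝓓(Ω, Eu m)),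
    -∫ z, deriv η z.1 * inner ℝ (u z) (φ z.2) ∂(volCyl T Ω) =
      (∫ z, η z.1 * inner ℝ (f z) (φ z.2) ∂(volCyl T Ω)) +
        ∫ t, η t * g t (W01p.ofTest φ) ∂(volTime T)

lemma volCyl_eq : volCyl T Ω = (volTime T).prod (volOn Ω) := by
  rw [Measure.prod_restrict]; rfl

lemma IsSlices.zero : IsSlices (0 : Lp (Eu m) ∞ (volCyl T Ω))
    (0 : Lp (W01p Ω m p) p (volTime T)) := by
  have h1 := Lp.coeFn_zero (Eu m) ∞ (volCyl T Ω)
  nth_rewrite 1 [volCyl_eq] at h1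
  filter_upwards [Measure.ae_ae_of_ae_prod h1, Lp.coeFn_zero (W01p Ω m p) p (volTime T)]
    with t h2 h3
  filter_upwards [h2, Lp.coeFn_zero (Eu m) p (volOn Ω)] with x h4 h5
  rw [h4, h3, Pi.zero_apply, map_zero]
  exact h5

lemma IsSlices.add {u v : Lp (Eu m) ∞ (volCyl T Ω)} {U V : Lp (W01p Ω m p) p (volTime T)}
    (hu : IsSlices u U) (hv : IsSlices v V) : IsSlices (u + v) (U + V) := by
  have h1 := Lp.coeFn_add u v
  nth_rewrite 1 [volCyl_eq] at h1
  filter_upwards [hu, hv, Measure.ae_ae_of_ae_prod h1, Lp.coeFn_add U V] with t hu hv h2 h3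
  filter_upwards [hu, hv, h2, Lp.coeFn_add (W01p.val (U t)) (W01p.val (V t))] with x hu hv h4 h5
  rw [h4, h3, Pi.add_apply, Pi.add_apply, map_add, ← hu, ← hv]
  exact h5

lemma IsSlices.smul {u : Lp (Eu m) ∞ (volCyl T Ω)} {U : Lp (W01p Ω m p) p (volTime T)} (c : ℝ)
    (hu : IsSlices u U) : IsSlices (c • u) (c • U) := by
  have h1 := Lp.coeFn_smul c u
  nth_rewrite 1 [volCyl_eq] at h1
  filter_upwards [hu, Measure.ae_ae_of_ae_prod h1, Lp.coeFn_smul c U] with t hu h2 h3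
  filter_upwards [hu, h2, Lp.coeFn_smul c (W01p.val (U t))] with x hu h4 h5
  rw [h4, h3, Pi.smul_apply, Pi.smul_apply, map_smul, ← hu]
  exact h5

lemma integrable_cyl {q : ℝ≥0∞} [Fact (1 ≤ q)] (f : Lp (Eu m) q (volCyl T Ω)) {a : ℝ → ℝ}
    (ha : Continuous a) (ha' : HasCompactSupport a) (φ : 𝓓(Ω, Eu m)) :
    Integrable (fun z => a z.1 * inner ℝ (f z) (φ z.2)) (volCyl T Ω) := by
  have hψ : MemLp (fun z : ℝ × Eu d => a z.1 • φ z.2) q.conjExponent (volCyl T Ω) := by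
    refine Continuous.memLp_of_hasCompactSupport (by fun_prop) ?_
    refine HasCompactSupport.intro (K := tsupport a ×ˢ tsupport φ)
      (ha'.isCompact.prod φ.hasCompactSupport.isCompact) fun z hz => ?_
    by_cases h : z.1 ∈ tsupport a
    · have : z.2 ∉ tsupport φ := fun h' => hz ⟨h, h'⟩
      simp [image_eq_zero_of_notMem_tsupport this]
    · simp [image_eq_zero_of_notMem_tsupport h]
  have := (Lp.memLp f).norm.integrable_mul (hψ.norm)
  refine this.mono' ?_ (Filter.Eventually.of_forall fun z => ?_)
  · have := (Lp.aestronglyMeasurable f).inner (𝕜 := ℝ) hψ.aestronglyMeasurable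
    refine this.congr (Filter.Eventually.of_forall fun z => ?_)
    simp [inner_smul_right]
  · rw [← inner_smul_right]
    exact norm_inner_le_norm _ _

lemma integrable_time (g : Lp (Wneg Ω m p) p.conjExponent (volTime T)) (η : 𝓓(timeOpens T, ℝ))
    (w : W01p Ω m p) : Integrable (fun t => η t * g t w) (volTime T) := by
  have hg : MemLp (fun t => g t w) p.conjExponent (volTime T) :=
    (ContinuousLinearMap.apply ℝ ℝ w : Wneg Ω m p →L[ℝ] ℝ).comp_memLp' (Lp.memLp g)
  have hη : MemLp η p (volTime T) :=
    η.continuous.memLp_of_hasCompactSupport η.hasCompactSupport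
  exact hη.integrable_mul hg

lemma continuous_deriv_test (η : 𝓓(timeOpens T, ℝ)) : Continuous (deriv η) :=
  η.contDiff.continuous_deriv (by simp)

lemma HasTimeDeriv.zero : HasTimeDeriv (0 : Lp (Eu m) ∞ (volCyl T Ω))
    (0 : Lp (Eu m) p (volCyl T Ω)) (0 : Lp (Wneg Ω m p) p.conjExponent (volTime T)) := by
  intro η φ
  have h1 : ∫ z, deriv η z.1 * inner ℝ ((0 : Lp (Eu m) ∞ (volCyl T Ω)) z) (φ z.2) ∂(volCyl T Ω)
      = 0 := integral_eq_zero_of_ae <| by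
    filter_upwards [Lp.coeFn_zero (Eu m) ∞ (volCyl T Ω)] with z hz
    rw [hz]; simp
  have h2 : ∫ z, η z.1 * inner ℝ ((0 : Lp (Eu m) p (volCyl T Ω)) z) (φ z.2) ∂(volCyl T Ω)
      = 0 := integral_eq_zero_of_ae <| by
    filter_upwards [Lp.coeFn_zero (Eu m) p (volCyl T Ω)] with z hz
    rw [hz]; simp
  have h3 : ∫ t, η t * (0 : Lp (Wneg Ω m p) p.conjExponent (volTime T)) t (W01p.ofTest φ)
      ∂(volTime T) = 0 := integral_eq_zero_of_ae <| by
    filter_upwards [Lp.coeFn_zero (Wneg Ω m p) p.conjExponent (volTime T)] with z hz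
    rw [hz]; simp
  rw [h1, h2, h3]; simp

lemma HasTimeDeriv.add {u₁ u₂ : Lp (Eu m) ∞ (volCyl T Ω)} {f₁ f₂ : Lp (Eu m) p (volCyl T Ω)}
    {g₁ g₂ : Lp (Wneg Ω m p) p.conjExponent (volTime T)}
    (h₁ : HasTimeDeriv u₁ f₁ g₁) (h₂ : HasTimeDeriv u₂ f₂ g₂) :
    HasTimeDeriv (u₁ + u₂) (f₁ + f₂) (g₁ + g₂) := by
  intro η φ
  have hη' := continuous_deriv_test η
  have hs' : HasCompactSupport (deriv η) := η.hasCompactSupport.deriv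
  have e1 : ∫ z, deriv η z.1 * inner ℝ ((u₁ + u₂) z) (φ z.2) ∂(volCyl T Ω) =
      (∫ z, deriv η z.1 * inner ℝ (u₁ z) (φ z.2) ∂(volCyl T Ω)) +
        ∫ z, deriv η z.1 * inner ℝ (u₂ z) (φ z.2) ∂(volCyl T Ω) := by
    rw [← integral_add (integrable_cyl u₁ hη' hs' φ) (integrable_cyl u₂ hη' hs' φ)]
    refine integral_congr_ae ?_
    filter_upwards [Lp.coeFn_add u₁ u₂] with z hz
    rw [hz, Pi.add_apply, inner_add_left, mul_add]
  have e2 : ∫ z, η z.1 * inner ℝ ((f₁ + f₂) z) (φ z.2) ∂(volCyl T Ω) =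
      (∫ z, η z.1 * inner ℝ (f₁ z) (φ z.2) ∂(volCyl T Ω)) +
        ∫ z, η z.1 * inner ℝ (f₂ z) (φ z.2) ∂(volCyl T Ω) := by
    rw [← integral_add (integrable_cyl f₁ η.continuous η.hasCompactSupport φ)
      (integrable_cyl f₂ η.continuous η.hasCompactSupport φ)]
    refine integral_congr_ae ?_
    filter_upwards [Lp.coeFn_add f₁ f₂] with z hz
    rw [hz, Pi.add_apply, inner_add_left, mul_add]
  have e3 : ∫ t, η t * (g₁ + g₂) t (W01p.ofTest φ) ∂(volTime T) =
      (∫ t, η t * g₁ t (W01p.ofTest φ) ∂(volTime T)) +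
        ∫ t, η t * g₂ t (W01p.ofTest φ) ∂(volTime T) := by
    rw [← integral_add (integrable_time g₁ η _) (integrable_time g₂ η _)]
    refine integral_congr_ae ?_
    filter_upwards [Lp.coeFn_add g₁ g₂] with z hz
    rw [hz, Pi.add_apply, add_apply, mul_add]
  rw [e1, e2, e3]
  linarith [h₁ η φ, h₂ η φ]

lemma HasTimeDeriv.smul {u : Lp (Eu m) ∞ (volCyl T Ω)} {f : Lp (Eu m) p (volCyl T Ω)}
    {g : Lp (Wneg Ω m p) p.conjExponent (volTime T)} (c : ℝ) (h : HasTimeDeriv u f g) :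
    HasTimeDeriv (c • u) (c • f) (c • g) := by
  intro η φ
  have e1 : ∫ z, deriv η z.1 * inner ℝ ((c • u) z) (φ z.2) ∂(volCyl T Ω) =
      c * ∫ z, deriv η z.1 * inner ℝ (u z) (φ z.2) ∂(volCyl T Ω) := by
    rw [← integral_const_mul]
    refine integral_congr_ae ?_
    filter_upwards [Lp.coeFn_smul c u] with z hz
    rw [hz, Pi.smul_apply, real_inner_smul_left]; ring
  have e2 : ∫ z, η z.1 * inner ℝ ((c • f) z) (φ z.2) ∂(volCyl T Ω) =
      c * ∫ z, η z.1 * inner ℝ (f z) (φ z.2) ∂(volCyl T Ω) := by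
    rw [← integral_const_mul]
    refine integral_congr_ae ?_
    filter_upwards [Lp.coeFn_smul c f] with z hz
    rw [hz, Pi.smul_apply, real_inner_smul_left]; ring
  have e3 : ∫ t, η t * (c • g) t (W01p.ofTest φ) ∂(volTime T) =
      c * ∫ t, η t * g t (W01p.ofTest φ) ∂(volTime T) := by
    rw [← integral_const_mul]
    refine integral_congr_ae ?_
    filter_upwards [Lp.coeFn_smul c g] with z hz
    rw [hz, Pi.smul_apply, smul_apply, smul_eq_mul]; ring
  rw [e1, e2, e3, ← mul_add, ← h η φ]; ring

variable (Ω m p T)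

/-- The space
`W = {u ∈ L^∞(Ω_T) ∩ L^p(0,T; W^{1,p}_0(Ω)) | ∂ₜu ∈ L^p(0,T; L^p(Ω)) + L^{p'}(0,T; W^{-1,p'}(Ω))}`
of `ℝᵐ`-valued functions. -/
def spaceW : Submodule ℝ (Lp (Eu m) ∞ (volCyl T Ω)) where
  carrier := {u | (∃ U : Lp (W01p Ω m p) p (volTime T), IsSlices u U) ∧
    ∃ (f : Lp (Eu m) p (volCyl T Ω)) (g : Lp (Wneg Ω m p) p.conjExponent (volTime T)),
      HasTimeDeriv u f g}
  zero_mem' := ⟨⟨0, .zero⟩, 0, 0, .zero⟩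
  add_mem' := by
    rintro u v ⟨⟨U, hU⟩, f₁, g₁, h₁⟩ ⟨⟨V, hV⟩, f₂, g₂, h₂⟩
    exact ⟨⟨U + V, hU.add hV⟩, f₁ + f₂, g₁ + g₂, h₁.add h₂⟩
  smul_mem' := by
    rintro c u ⟨⟨U, hU⟩, f, g, h⟩
    exact ⟨⟨c • U, hU.smul c⟩, c • f, c • g, h.smul c⟩

variable {Ω m p T}

/-- The norm of `u` in `L^p(0,T; W^{1,p}_0(Ω))`: the norm of the class `t ↦ u(t,·)`, which is
determined by `u` (so the infimum runs over a single value). -/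
def normLpW (u : spaceW Ω m p T) : ℝ :=
  sInf {r | ∃ U : Lp (W01p Ω m p) p (volTime T), IsSlices (u : Lp (Eu m) ∞ (volCyl T Ω)) U ∧
    r = ‖U‖}

/-- The norm of `∂ₜu` in the sum `L^p(0,T; L^p(Ω)) + L^{p'}(0,T; W^{-1,p'}(Ω))`. -/
def normTimeDeriv (u : spaceW Ω m p T) : ℝ :=
  sInf {r | ∃ (f : Lp (Eu m) p (volCyl T Ω)) (g : Lp (Wneg Ω m p) p.conjExponent (volTime T)),
    HasTimeDeriv (u : Lp (Eu m) ∞ (volCyl T Ω)) f g ∧ r = ‖f‖ + ‖g‖}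

/-- The norm of `W`. -/
def normW (u : spaceW Ω m p T) : ℝ :=
  ‖(u : Lp (Eu m) ∞ (volCyl T Ω))‖ + normLpW u + normTimeDeriv u

/-- The space `C([0,T]; L²(Ω; ℝᵐ))` with the supremum norm. -/
abbrev CTimeL2 {d : ℕ} (Ω : Opens (Eu d)) (m : ℕ) (T : ℝ) : Type :=
  C(Icc (0 : ℝ) T, Lp (Eu m) 2 (volOn Ω))

/-- `v ∈ C([0,T]; L²(Ω))` is a representative of `u`: `v(t) = u(t,·)` a.e. in `Ω`, for almost
every `t ∈ (0,T)`. -/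
def IsContRep (u : Lp (Eu m) ∞ (volCyl T Ω)) (v : CTimeL2 Ω m T) : Prop :=
  ∀ᵐ t ∂(volTime T), ∀ ht : t ∈ Icc (0 : ℝ) T, ∀ᵐ x ∂(volOn Ω), v ⟨t, ht⟩ x = u (t, x)

end Bochner

end ParabolicW

end

/-!
The bound for `J` only uses the `L^∞` part of the norm, because `Ω` has finite measure; the content
is that the slices `u(t)` depend continuously on `t` in `L²(Ω)`. With `F = f + g`, the idea is to
bound the increments of the energy `‖u(t) - c‖²` for `c` a slice of `u`.

*Testing with slices* (`HasTimeDeriv.exists_abs_inner_le`). For a test function `φ`, the weak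
formulation with a smoothed indicator of `[s, t]` in time bounds `⟪u(t) - u(s), φ⟫` at right
Lebesgue points `s`, `t` of the `L²`-valued map `u` (`abs_sub_le_of_weak_deriv`). A slice `u(r)` is a
bounded element of `W^{1,p}_0`; composing approximating test functions with a smooth truncation
gives test functions `φ` bounded both uniformly and in `W^{1,p}_0` which converge to `u(r)` in `L^p`
(`exists_bounded_test_approx`). A uniform bound suffices for the pairing with `f`, a bound in
`W^{1,p}_0` for the pairing with `g`. With Young's inequality this gives an integrable function
`K ≥ 0` with
`|⟪u(t) - u(s), u(r)⟫| ≤ ∫_s^t K + (t - s) K(r)` for almost all `s ≤ t` and `r`.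

*Energy argument* (`abs_energy_sub_le`, `norm_sub_sq_le`). For `E(t) = ‖u(t) - u(c)‖²` one has
`E(t + h) - E(t) = ⟪u(t + h) - u(t), u(t + h) + u(t) - 2 u(c)⟫`. Integrating over `[a, b]`, dividing
by `h` and letting `h ↓ 0` yields `|E(b) - E(a)| ≤ 6 ∫_a^b K + 2 (b - a) K(c)`. Comparing `u(s)` and
`u(t)` with `u(r)`, for an `r` between them at which `K` does not exceed its mean, gives
`‖u(t) - u(s)‖² ≤ 16 ∫_s^t K`. Hence `u` is uniformly continuous on a set of full measure and
extends to `[0, T]` (`exists_continuous_of_inner_le`).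

That `t ↦ u(t)` is strongly measurable with values in `L²(Ω)`, as the Lebesgue points require, follows
from its measurability in `L^p(Ω)` (`aestronglyMeasurable_of_inclusion`). This is where `p ≤ 2` is
used.
-/

namespace ParabolicW

open Filter Topology

/-! ### One-sided Lebesgue points -/

/-- `t` is a right Lebesgue point of `u` with value `u t`: the mean of `‖u - u t‖` over `[t, t + h]`
tends to `0` as `h ↓ 0`. -/
def RightLebesguePoint {E : Type*} [NormedAddCommGroup E] (u : ℝ → E) (t : ℝ) : Prop :=
  Tendsto (fun h => h⁻¹ * ∫ τ in t..t + h, ‖u τ - u t‖) (𝓝[>] 0) (𝓝 0)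

section LebesguePoints

variable {E F : Type*} [NormedAddCommGroup E] [NormedAddCommGroup F]

lemma ae_rightLebesguePoint {u : ℝ → E} (hu : LocallyIntegrable u) :
    ∀ᵐ t, RightLebesguePoint u t := by
  filter_upwards [(IsUnifLocDoublingMeasure.vitaliFamily (volume : Measure ℝ)
    1).ae_tendsto_average_norm_sub hu] with t ht
  have hshift : Tendsto (fun h : ℝ => t + h) (𝓝[>] 0) (𝓝[>] t) := by
    refine tendsto_nhdsWithin_iff.2 ⟨?_, ?_⟩
    · have : Tendsto (fun h : ℝ => t + h) (𝓝 0) (𝓝 (t + 0)) :=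
        (continuous_const.add continuous_id).tendsto 0
      rw [add_zero] at this
      exact this.mono_left nhdsWithin_le_nhds
    · filter_upwards [self_mem_nhdsWithin] with h hh
      simpa using hh
  refine ((ht.comp (Real.tendsto_Icc_vitaliFamily_right t)).comp hshift).congr' ?_
  filter_upwards [self_mem_nhdsWithin] with h (hh : 0 < h)
  simp only [Function.comp_apply]
  rw [setAverage_eq, intervalIntegral.integral_of_le (by linarith), integral_Icc_eq_integral_Ioc,
    smul_eq_mul]
  simp [Measure.real, Real.volume_Icc, hh.le]

lemma RightLebesguePoint.of_norm_le {u : ℝ → E} {v : ℝ → F} {t C : ℝ}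
    (hu : RightLebesguePoint u t) (hui : LocallyIntegrable u) (hvi : LocallyIntegrable v)
    (h : ∀ τ, ‖v τ - v t‖ ≤ C * ‖u τ - u t‖) : RightLebesguePoint v t := by
  have hlim := Tendsto.const_mul C hu
  rw [mul_zero] at hlim
  refine squeeze_zero' ?_ ?_ hlim
  · filter_upwards [self_mem_nhdsWithin] with h (hh : 0 < h)
    exact mul_nonneg (inv_nonneg.2 hh.le)
      (intervalIntegral.integral_nonneg (by linarith) fun _ _ => norm_nonneg _)
  · filter_upwards [self_mem_nhdsWithin] with ε (hε : 0 < ε)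
    rw [mul_left_comm C, ← intervalIntegral.integral_const_mul C]
    refine mul_le_mul_of_nonneg_left ?_ (inv_nonneg.2 hε.le)
    have h1 : IntervalIntegrable (fun τ => v τ - v t) volume t (t + ε) :=
      ((hvi.integrableOn_isCompact isCompact_uIcc).intervalIntegrable).sub
        intervalIntegrable_const
    have h2 : IntervalIntegrable (fun τ => u τ - u t) volume t (t + ε) :=
      ((hui.integrableOn_isCompact isCompact_uIcc).intervalIntegrable).sub
        intervalIntegrable_const
    exact intervalIntegral.integral_mono (by linarith) h1.norm (h2.norm.const_mul C) h

lemma RightLebesguePoint.tendsto_average {α : ℝ → ℝ} {t : ℝ} (hα : RightLebesguePoint α t)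
    (hi : LocallyIntegrable α) :
    Tendsto (fun h => h⁻¹ * ∫ τ in t..t + h, α τ) (𝓝[>] 0) (𝓝 (α t)) := by
  rw [tendsto_iff_norm_sub_tendsto_zero]
  refine squeeze_zero' (Eventually.of_forall fun _ => norm_nonneg _) ?_ hα
  filter_upwards [self_mem_nhdsWithin] with h (hh : 0 < h)
  have h1 : IntervalIntegrable α volume t (t + h) :=
    (hi.integrableOn_isCompact isCompact_uIcc).intervalIntegrable
  have h2 : h⁻¹ * (∫ τ in t..t + h, α τ) - α t = h⁻¹ * ∫ τ in t..t + h, (α τ - α t) := by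
    rw [intervalIntegral.integral_sub h1 intervalIntegrable_const,
      intervalIntegral.integral_const]
    simp only [add_sub_cancel_left, smul_eq_mul]
    field_simp
  rw [h2, norm_mul, Real.norm_of_nonneg (inv_nonneg.2 hh.le)]
  exact mul_le_mul_of_nonneg_left (intervalIntegral.norm_integral_le_integral_norm (by linarith))
    (inv_nonneg.2 hh.le)

end LebesguePoints

/-! ### Continuity from an energy inequality in a Hilbert space -/

/-- A set of full measure in `(0, T)` is dense in `[0, T]`. -/
lemma dense_of_ae {T : ℝ} (hT : 0 < T) {D : Set ℝ} (hD : ∀ᵐ t, t ∈ Ioo 0 T → t ∈ D) :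
    Dense {t : Icc (0 : ℝ) T | (t : ℝ) ∈ D} := by
  rw [Metric.dense_iff]
  intro x ε hε
  have hx := x.2
  -- an open interval inside `(0, T)` and close to `x`
  obtain ⟨y, z, hyz, hy0, hzT, hyx, hzx⟩ : ∃ y z : ℝ, y < z ∧ 0 ≤ y ∧ z ≤ T ∧
      x - ε < y ∧ z < x + ε := by
    rcases hx.2.lt_or_eq with hlt | heq
    · exact ⟨x, min T (x + ε / 2), lt_min hlt (by linarith), hx.1, min_le_left _ _, by linarith,
        (min_le_right _ _).trans_lt (by linarith)⟩
    · refine ⟨max 0 (x - ε / 2), x, max_lt (by linarith) (by linarith), le_max_left _ _, hx.2,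
        lt_of_lt_of_le (by linarith) (le_max_right _ _), by linarith⟩
  have hne : (ae (volume.restrict (Ioo y z))).NeBot := by
    rw [ae_neBot]; simp [hyz]
  obtain ⟨t, ht, htD⟩ := (((ae_restrict_mem measurableSet_Ioo).and
    (ae_restrict_of_ae hD)).exists : ∃ t, t ∈ Ioo y z ∧ (t ∈ Ioo 0 T → t ∈ D))
  have ht0 : t ∈ Ioo 0 T := ⟨hy0.trans_lt ht.1, ht.2.trans_le hzT⟩
  refine ⟨⟨t, ht0.1.le, ht0.2.le⟩, ?_, htD ht0⟩
  rw [Metric.mem_ball, Subtype.dist_eq, Real.dist_eq, abs_lt]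
  constructor <;> simp only <;> linarith [ht.1, ht.2]

section Energy

variable {H : Type*} [NormedAddCommGroup H] [InnerProductSpace ℝ H] {T R : ℝ} {u : ℝ → H}
  {K : ℝ → ℝ} {D : Set ℝ}

lemma norm_sub_sq_sub_norm_sub_sq (x y c : H) :
    ‖y - c‖ ^ 2 - ‖x - c‖ ^ 2 = inner ℝ (y - x) y + inner ℝ (y - x) x - 2 * inner ℝ (y - x) c := by
  simp only [norm_sub_sq_real, inner_sub_left, real_inner_self_eq_norm_sq]
  rw [real_inner_comm x y]
  ring

/-- The increment of the energy `‖u - u c‖²` between two right Lebesgue points.  The difference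
`‖u (t + h) - u c‖² - ‖u t - u c‖²` is the pairing of `u (t + h) - u t` with
`u (t + h) + u t - 2 u c`; it is integrated over `t ∈ [a, b]` and divided by `h ↓ 0`. -/
lemma abs_energy_sub_le (hu : Integrable u) (hR : ∀ t, ‖u t‖ ≤ R) (hK : Integrable K)
    (hK0 : ∀ t, 0 ≤ K t) (hDT : D ⊆ Ioo 0 T) (hD : ∀ᵐ t, t ∈ Ioo 0 T → t ∈ D)
    (hleb : ∀ t ∈ D, RightLebesguePoint u t)
    (h : ∀ s ∈ D, ∀ t ∈ D, ∀ r ∈ D, s ≤ t →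
      |inner ℝ (u t - u s) (u r)| ≤ (∫ τ in s..t, K τ) + (t - s) * K r)
    {a b c : ℝ} (ha : a ∈ D) (hb : b ∈ D) (hc : c ∈ D) (hab : a ≤ b) :
    |‖u b - u c‖ ^ 2 - ‖u a - u c‖ ^ 2| ≤ 6 * (∫ τ in a..b, K τ) + 2 * (b - a) * K c := by
  set E : ℝ → ℝ := fun t => ‖u t - u c‖ ^ 2 with hE
  have hEdiff : ∀ s t, ‖E t - E s‖ ≤ 4 * R * ‖u t - u s‖ := by
    intro s t
    have h1 : E t - E s = (‖u t - u c‖ + ‖u s - u c‖) * (‖u t - u c‖ - ‖u s - u c‖) := by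
      simp only [hE]; ring
    rw [h1, norm_mul]
    have h2 : |‖u t - u c‖ - ‖u s - u c‖| ≤ ‖u t - u s‖ := by
      simpa using abs_norm_sub_norm_le (u t - u c) (u s - u c)
    have h3 : ‖u t - u c‖ ≤ R + R := (norm_sub_le _ _).trans (add_le_add (hR _) (hR _))
    have h4 : ‖u s - u c‖ ≤ R + R := (norm_sub_le _ _).trans (add_le_add (hR _) (hR _))
    refine mul_le_mul ?_ h2 (norm_nonneg _) (by linarith [norm_nonneg (u t - u c)])
    rw [Real.norm_of_nonneg (by positivity)]
    linarith
  have hEm : AEStronglyMeasurable E := ((hu.1.sub aestronglyMeasurable_const).norm).pow 2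
  have hEl : LocallyIntegrable E := by
    have h1 : LocallyIntegrable (fun t => (4 * R) • (u t - u c)) :=
      (hu.locallyIntegrable.sub (locallyIntegrable_const (u c))).smul (4 * R)
    refine h1.mono hEm (Eventually.of_forall fun t => ?_)
    have h2 := hEdiff c t
    rw [show E t - E c = E t by simp [hE]] at h2
    rw [norm_smul]
    exact h2.trans (mul_le_mul_of_nonneg_right (le_abs_self _) (norm_nonneg _))
  have hEi : ∀ x y, IntervalIntegrable E volume x y := fun x y =>
    (hEl.integrableOn_isCompact isCompact_uIcc).intervalIntegrable
  have hKi : ∀ x y, IntervalIntegrable K volume x y := fun x y => hK.intervalIntegrable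
  have hEleb : ∀ t ∈ D, Tendsto (fun ε => ε⁻¹ * ∫ τ in t..t + ε, E τ) (𝓝[>] 0) (𝓝 (E t)) :=
    fun t ht => ((hleb t ht).of_norm_le hu.locallyIntegrable hEl (hEdiff t)).tendsto_average hEl
  set P : ℝ → ℝ := fun t => ∫ τ in (0 : ℝ)..t, K τ with hP
  have hPc : Continuous P := intervalIntegral.continuous_primitive hKi 0
  have hPsub : ∀ s t, ∫ τ in s..t, K τ = P t - P s := fun s t =>
    (intervalIntegral.integral_interval_sub_left (hKi 0 t) (hKi 0 s)).symm
  have hPm : Monotone P := by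
    intro s t hst
    have := intervalIntegral.integral_nonneg (μ := volume) hst fun τ _ => hK0 τ
    rw [hPsub] at this
    linarith
  have key : ∀ᶠ ε in 𝓝[>] (0 : ℝ),
      |ε⁻¹ * (∫ τ in b..b + ε, E τ) - ε⁻¹ * ∫ τ in a..a + ε, E τ| ≤
        6 * (P (b + ε) - P a) + 2 * (b - a) * K c := by
    filter_upwards [Ioo_mem_nhdsGT (sub_pos.2 (hDT hb).2)] with ε hε
    have hε0 : 0 < ε := hε.1
    have hεT : b + ε < T := by linarith [hε.2]
    have hsh : ∀ {f : ℝ → ℝ}, (∀ x y, IntervalIntegrable f volume x y) →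
        ∀ x y, IntervalIntegrable (fun t => f (t + ε)) volume x y := by
      intro f hf x y
      simpa using (hf (x + ε) (y + ε)).comp_add_right ε
    have e1 : (∫ τ in b..b + ε, E τ) - ∫ τ in a..a + ε, E τ = ∫ t in a..b, (E (t + ε) - E t) := by
      rw [intervalIntegral.integral_sub (hsh hEi _ _) (hEi _ _),
        intervalIntegral.integral_comp_add_right]
      have h1 := intervalIntegral.integral_add_adjacent_intervals (hEi a b) (hEi b (b + ε))
      have h2 := intervalIntegral.integral_add_adjacent_intervals (hEi a (a + ε))
        (hEi (a + ε) (b + ε))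
      linarith
    have hPi : ∀ x y, IntervalIntegrable P volume x y := fun x y => hPc.intervalIntegrable x y
    -- Both integrals over intervals of length `ε` are compared with the extreme values of the
    -- monotone primitive `P`, which replaces an interchange of integrals.
    have e2 : ∫ t in a..b, (P (t + ε) - P t) ≤ ε * (P (b + ε) - P a) := by
      rw [intervalIntegral.integral_sub (hsh hPi _ _) (hPi _ _),
        intervalIntegral.integral_comp_add_right]
      have h1 := intervalIntegral.integral_add_adjacent_intervals (hPi a b) (hPi b (b + ε))
      have h2 := intervalIntegral.integral_add_adjacent_intervals (hPi a (a + ε))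
        (hPi (a + ε) (b + ε))
      have h3 : ∫ t in b..b + ε, P t ≤ ∫ _ in b..b + ε, P (b + ε) :=
        intervalIntegral.integral_mono_on (by linarith) (hPi _ _) intervalIntegrable_const
          fun t ht => hPm ht.2
      have h4 : ∫ _ in a..a + ε, P a ≤ ∫ t in a..a + ε, P t :=
        intervalIntegral.integral_mono_on (by linarith) intervalIntegrable_const (hPi _ _)
          fun t ht => hPm ht.1
      simp only [intervalIntegral.integral_const, add_sub_cancel_left, smul_eq_mul] at h3 h4
      linarith
    have e3 : ∫ t in a..b, (K (t + ε) + K t) ≤ 2 * (P (b + ε) - P a) := by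
      rw [intervalIntegral.integral_add (hsh hKi _ _) (hKi _ _),
        intervalIntegral.integral_comp_add_right, hPsub, hPsub]
      have h1 : P a ≤ P (a + ε) := hPm (by linarith)
      have h2 : P b ≤ P (b + ε) := hPm (by linarith)
      linarith
    have hDshift : ∀ᵐ t : ℝ, t + ε ∈ Ioo 0 T → t + ε ∈ D :=
      (measurePreserving_add_right volume ε).quasiMeasurePreserving.ae hD
    -- The hypothesis `h` is used with the three reference points `t + ε`, `t` and `c`.
    have e4 : |∫ t in a..b, (E (t + ε) - E t)| ≤
        ∫ t in a..b, (4 * (P (t + ε) - P t) + ε * (K (t + ε) + K t) + ε * (2 * K c)) := by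
      rw [← Real.norm_eq_abs]
      refine intervalIntegral.norm_integral_le_of_norm_le hab ?_ ?_
      · filter_upwards [hD, hDshift] with t h1 h2 ht
        have ht0 : 0 < t := (hDT ha).1.trans ht.1
        have h1 : t ∈ D := h1 ⟨ht0, by linarith [ht.2]⟩
        have h2 : t + ε ∈ D := h2 ⟨by linarith, by linarith [ht.2]⟩
        have k1 := h t h1 (t + ε) h2 (t + ε) h2 (by linarith)
        have k2 := h t h1 (t + ε) h2 t h1 (by linarith)
        have k3 := h t h1 (t + ε) h2 c hc (by linarith)
        rw [hPsub, add_sub_cancel_left, abs_le] at k1 k2 k3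
        simp only [hE]
        rw [norm_sub_sq_sub_norm_sub_sq, Real.norm_eq_abs, abs_le]
        constructor <;> linarith [k1.1, k1.2, k2.1, k2.2, k3.1, k3.2]
      · exact ((((hsh hPi _ _).sub (hPi _ _)).const_mul 4).add
          (((hsh hKi _ _).add (hKi _ _)).const_mul ε)).add intervalIntegrable_const
    rw [intervalIntegral.integral_add ((((hsh hPi _ _).sub (hPi _ _)).const_mul 4).add
        (((hsh hKi _ _).add (hKi _ _)).const_mul ε)) intervalIntegrable_const,
      intervalIntegral.integral_add (((hsh hPi _ _).sub (hPi _ _)).const_mul 4)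
        (((hsh hKi _ _).add (hKi _ _)).const_mul ε),
      intervalIntegral.integral_const_mul, intervalIntegral.integral_const_mul,
      intervalIntegral.integral_const, smul_eq_mul] at e4
    rw [← mul_sub, abs_mul, abs_of_pos (inv_pos.2 hε0), e1, inv_mul_le_iff₀ hε0]
    have e5 := mul_le_mul_of_nonneg_left e3 hε0.le
    linarith
  have hR1 : Tendsto (fun ε => 6 * (P (b + ε) - P a) + 2 * (b - a) * K c) (𝓝[>] 0)
      (𝓝 (6 * (P b - P a) + 2 * (b - a) * K c)) := by
    have h1 : Continuous fun ε => 6 * (P (b + ε) - P a) + 2 * (b - a) * K c := by fun_prop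
    have h2 := h1.tendsto 0
    rw [add_zero] at h2
    exact h2.mono_left nhdsWithin_le_nhds
  rw [hPsub]
  exact le_of_tendsto_of_tendsto ((hEleb b hb).sub (hEleb a ha)).abs hR1 key

/-- The modulus of continuity.  The reference point `r` between `s` and `t` is chosen so that
`(t - s) K r` does not exceed the integral of `K`; this removes the pointwise value of `K`. -/
lemma norm_sub_sq_le (hu : Integrable u) (hR : ∀ t, ‖u t‖ ≤ R) (hK : Integrable K)
    (hK0 : ∀ t, 0 ≤ K t) (hDT : D ⊆ Ioo 0 T) (hD : ∀ᵐ t, t ∈ Ioo 0 T → t ∈ D)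
    (hleb : ∀ t ∈ D, RightLebesguePoint u t)
    (h : ∀ s ∈ D, ∀ t ∈ D, ∀ r ∈ D, s ≤ t →
      |inner ℝ (u t - u s) (u r)| ≤ (∫ τ in s..t, K τ) + (t - s) * K r)
    {s t : ℝ} (hs : s ∈ D) (ht : t ∈ D) (hst : s < t) :
    ‖u t - u s‖ ^ 2 ≤ 16 * ∫ τ in s..t, K τ := by
  obtain ⟨r, hrN, hr⟩ := exists_notMem_null_le_average (μ := volume.restrict (Ioc s t)) (f := K)
    (N := {r | ¬ (r ∈ Ioc s t ∧ r ∈ D)}) (by simp [hst]) hK.integrableOn <| by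
      rw [← compl_ofPred, ← mem_ae_iff]
      filter_upwards [ae_restrict_mem measurableSet_Ioc, ae_restrict_of_ae hD] with r h1 h2
      exact ⟨h1, h2 ⟨(hDT hs).1.trans h1.1, h1.2.trans_lt (hDT ht).2⟩⟩
  simp only [mem_ofPred_eq, not_not] at hrN
  obtain ⟨⟨hsr, hrt⟩, hrD⟩ := hrN
  have hr' : (t - s) * K r ≤ ∫ τ in s..t, K τ := by
    rw [setAverage_eq, ← intervalIntegral.integral_of_le hst.le, Real.volume_real_Ioc_of_le hst.le,
      smul_eq_mul] at hr
    rwa [← le_inv_mul_iff₀ (sub_pos.2 hst)]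
  have h1 := abs_energy_sub_le hu hR hK hK0 hDT hD hleb h hrD ht hrD hrt
  have h2 := abs_energy_sub_le hu hR hK hK0 hDT hD hleb h hs hrD hrD hsr.le
  simp only [sub_self, norm_zero, ne_eq, OfNat.ofNat_ne_zero, not_false_eq_true, zero_pow,
    sub_zero, zero_sub, abs_neg, abs_pow, abs_norm] at h1 h2
  have h3 := intervalIntegral.integral_add_adjacent_intervals
    (hK.intervalIntegrable (a := s) (b := r)) (hK.intervalIntegrable (a := r) (b := t))
  have h4 : ‖u t - u s‖ ≤ ‖u t - u r‖ + ‖u s - u r‖ := by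
    rw [norm_sub_rev (u s)]; exact norm_sub_le_norm_sub_add_norm_sub _ _ _
  have h5 : ‖u t - u s‖ ^ 2 ≤ (‖u t - u r‖ + ‖u s - u r‖) ^ 2 := by gcongr
  nlinarith [sq_nonneg (‖u t - u r‖ - ‖u s - u r‖)]

/-- A bounded function which satisfies the energy inequality on a set of full measure agrees there
with a continuous function on the closed interval. -/
theorem exists_continuous_of_inner_le [CompleteSpace H] (hT : 0 < T) (hu : Integrable u)
    (hR : ∀ t, ‖u t‖ ≤ R) (hK : Integrable K)
    (hK0 : ∀ t, 0 ≤ K t) (hDT : D ⊆ Ioo 0 T) (hD : ∀ᵐ t, t ∈ Ioo 0 T → t ∈ D)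
    (hleb : ∀ t ∈ D, RightLebesguePoint u t)
    (h : ∀ s ∈ D, ∀ t ∈ D, ∀ r ∈ D, s ≤ t →
      |inner ℝ (u t - u s) (u r)| ≤ (∫ τ in s..t, K τ) + (t - s) * K r) :
    ∃ v : C(Icc (0 : ℝ) T, H), (∀ t ∈ D, ∀ ht : t ∈ Icc (0 : ℝ) T, v ⟨t, ht⟩ = u t) ∧
      ∀ t, ‖v t‖ ≤ R := by
  set P : ℝ → ℝ := fun t => ∫ τ in (0 : ℝ)..t, K τ with hP
  have hKi : ∀ x y, IntervalIntegrable K volume x y := fun x y => hK.intervalIntegrable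
  have hPc : Continuous P := intervalIntegral.continuous_primitive hKi 0
  have hPsub : ∀ s t, ∫ τ in s..t, K τ = P t - P s := fun s t =>
    (intervalIntegral.integral_interval_sub_left (hKi 0 t) (hKi 0 s)).symm
  have hmod : ∀ s ∈ D, ∀ t ∈ D, ‖u t - u s‖ ^ 2 ≤ 16 * |P t - P s| := by
    intro s hs t ht
    rcases lt_trichotomy s t with hst | rfl | hst
    · refine (norm_sub_sq_le hu hR hK hK0 hDT hD hleb h hs ht hst).trans ?_
      rw [hPsub]
      linarith [le_abs_self (P t - P s)]
    · simp
    · rw [norm_sub_rev, abs_sub_comm]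
      refine (norm_sub_sq_le hu hR hK hK0 hDT hD hleb h ht hs hst).trans ?_
      rw [hPsub]
      linarith [le_abs_self (P s - P t)]
  have hDense : Dense {t : Icc (0 : ℝ) T | (t : ℝ) ∈ D} := dense_of_ae hT hD
  set S : Set (Icc (0 : ℝ) T) := {t | (t : ℝ) ∈ D} with hS
  have hunif : UniformContinuous fun t : S => u (t : Icc (0 : ℝ) T) := by
    have hPu : UniformContinuous fun t : S => P (t : Icc (0 : ℝ) T) :=
      (CompactSpace.uniformContinuous_of_continuous
        (hPc.comp continuous_subtype_val)).comp uniformContinuous_subtype_val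
    rw [Metric.uniformContinuous_iff] at hPu ⊢
    intro ε hε
    obtain ⟨δ, hδ, hPδ⟩ := hPu (ε ^ 2 / 16) (by positivity)
    refine ⟨δ, hδ, fun {s t} hst => ?_⟩
    have h1 := hPδ hst
    have h2 := hmod _ t.2 _ s.2
    rw [Real.dist_eq] at h1
    rw [dist_eq_norm]
    exact lt_of_pow_lt_pow_left₀ 2 hε.le (h2.trans_lt (by linarith))
  have hcont := (hDense.uniformContinuous_extend hunif).continuous
  have hext : ∀ t : S, hDense.extend (fun t : S => u (t : Icc (0 : ℝ) T)) t =
      u (t : Icc (0 : ℝ) T) := hDense.extend_of_ind hunif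
  refine ⟨⟨_, hcont⟩, fun t htD ht => hext ⟨⟨t, ht⟩, htD⟩, fun t => ?_⟩
  refine hDense.induction (P := fun t => ‖hDense.extend (fun t : S => u (t : Icc (0 : ℝ) T)) t‖ ≤ R)
    (fun t ht => ?_) (isClosed_le hcont.norm continuous_const) t
  rw [hext ⟨t, ht⟩]
  exact hR _

end Energy

/-! ### Smoothed indicators of time intervals -/

/-- A smooth function of `τ` which is `0` for `τ ≤ s` and `1` for `τ ≥ s + ε`. -/
noncomputable def ramp (ε s τ : ℝ) : ℝ := Real.smoothTransition ((τ - s) / ε)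

lemma deriv_smoothTransition_eq_zero {x : ℝ} (hx : x ∉ Icc (0 : ℝ) 1) :
    deriv Real.smoothTransition x = 0 := by
  rw [mem_Icc, not_and_or, not_le, not_le] at hx
  rcases hx with hx | hx
  · have : Real.smoothTransition =ᶠ[𝓝 x] fun _ => 0 := by
      filter_upwards [Iio_mem_nhds hx] with y hy using Real.smoothTransition.zero_of_nonpos hy.le
    rw [this.deriv_eq, deriv_const]
  · have : Real.smoothTransition =ᶠ[𝓝 x] fun _ => 1 := by
      filter_upwards [Ioi_mem_nhds hx] with y hy using Real.smoothTransition.one_of_one_le hy.le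
    rw [this.deriv_eq, deriv_const]

lemma continuous_deriv_smoothTransition : Continuous (deriv Real.smoothTransition) :=
  (Real.smoothTransition.contDiff (n := 1)).continuous_deriv le_rfl

lemma exists_abs_deriv_smoothTransition_le : ∃ C, ∀ x, |deriv Real.smoothTransition x| ≤ C := by
  obtain ⟨C, hC⟩ := continuous_deriv_smoothTransition.bounded_above_of_compact_support
    (HasCompactSupport.intro isCompact_Icc fun x hx => deriv_smoothTransition_eq_zero hx)
  exact ⟨C, hC⟩

section Ramp

variable {ε s t : ℝ}

lemma contDiff_ramp {n : ℕ∞} : ContDiff ℝ n (ramp ε s) :=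
  Real.smoothTransition.contDiff.comp ((contDiff_id.sub contDiff_const).div_const ε)

lemma ramp_eq_zero (hε : 0 < ε) {τ : ℝ} (h : τ ≤ s) : ramp ε s τ = 0 :=
  Real.smoothTransition.zero_of_nonpos (div_nonpos_of_nonpos_of_nonneg (by linarith) hε.le)

lemma ramp_eq_one (hε : 0 < ε) {τ : ℝ} (h : s + ε ≤ τ) : ramp ε s τ = 1 :=
  Real.smoothTransition.one_of_one_le ((one_le_div₀ hε).2 (by linarith))

lemma deriv_ramp (τ : ℝ) : deriv (ramp ε s) τ = deriv Real.smoothTransition ((τ - s) / ε) / ε := by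
  have h1 : HasDerivAt Real.smoothTransition (deriv Real.smoothTransition ((τ - s) / ε))
      ((τ - s) / ε) :=
    ((Real.smoothTransition.contDiff (n := 1)).differentiable one_ne_zero _).hasDerivAt
  have h2 : HasDerivAt (fun τ => (τ - s) / ε) (1 / ε) τ :=
    ((hasDerivAt_id τ).sub_const s).div_const ε
  have h3 := (h1.comp τ h2).deriv
  rw [mul_one_div] at h3
  exact h3

lemma continuous_deriv_ramp : Continuous (deriv (ramp ε s)) :=
  (contDiff_ramp (n := 1)).continuous_deriv le_rfl

lemma deriv_ramp_eq_zero (hε : 0 < ε) {τ : ℝ} (h : τ ∉ Icc s (s + ε)) :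
    deriv (ramp ε s) τ = 0 := by
  rw [deriv_ramp, deriv_smoothTransition_eq_zero, zero_div]
  rw [mem_Icc, le_div_iff₀ hε, div_le_iff₀ hε]
  rw [mem_Icc] at h
  contrapose! h
  constructor <;> linarith [h.1, h.2]

lemma integrable_deriv_ramp_mul (hε : 0 < ε) {α : ℝ → ℝ} (hα : Integrable α) :
    Integrable fun τ => deriv (ramp ε s) τ * α τ := by
  obtain ⟨C, hC⟩ := (continuous_deriv_ramp (ε := ε) (s := s)).bounded_above_of_compact_support
    (HasCompactSupport.intro isCompact_Icc fun x hx => deriv_ramp_eq_zero hε hx)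
  exact hα.bdd_mul (c := C) continuous_deriv_ramp.aestronglyMeasurable (Eventually.of_forall hC)

/-- The derivatives of the ramps form an approximate identity at right Lebesgue points. -/
lemma tendsto_integral_deriv_ramp {α : ℝ → ℝ} (hα : Integrable α) (hs : RightLebesguePoint α s) :
    Tendsto (fun ε => ∫ τ, deriv (ramp ε s) τ * α τ) (𝓝[>] 0) (𝓝 (α s)) := by
  obtain ⟨C, hC⟩ := exists_abs_deriv_smoothTransition_le
  rw [tendsto_iff_norm_sub_tendsto_zero]
  have hlim := Tendsto.const_mul C hs
  rw [mul_zero] at hlim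
  refine squeeze_zero' (Eventually.of_forall fun _ => norm_nonneg _) ?_ hlim
  filter_upwards [self_mem_nhdsWithin] with ε (hε : 0 < ε)
  have hαi : IntervalIntegrable α volume s (s + ε) := hα.intervalIntegrable
  have h1 : ∫ τ, deriv (ramp ε s) τ * α τ = ∫ τ in s..s + ε, deriv (ramp ε s) τ * α τ := by
    rw [intervalIntegral.integral_of_le (by linarith), ← integral_Icc_eq_integral_Ioc]
    refine (setIntegral_eq_integral_of_forall_compl_eq_zero fun τ hτ => ?_).symm
    rw [deriv_ramp_eq_zero hε hτ, zero_mul]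
  have h2 : ∫ τ in s..s + ε, deriv (ramp ε s) τ = 1 := by
    rw [intervalIntegral.integral_deriv_eq_sub
      (fun τ _ => (contDiff_ramp (n := 1)).differentiable one_ne_zero τ)
      (continuous_deriv_ramp.intervalIntegrable _ _), ramp_eq_one hε le_rfl,
      ramp_eq_zero hε le_rfl, sub_zero]
  have h3 : (∫ τ in s..s + ε, deriv (ramp ε s) τ * α τ) - α s =
      ∫ τ in s..s + ε, deriv (ramp ε s) τ * (α τ - α s) := by
    have h4 := intervalIntegral.integral_sub
      (hαi.continuousOn_mul (continuous_deriv_ramp (ε := ε) (s := s)).continuousOn)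
      (((continuous_deriv_ramp (ε := ε) (s := s)).intervalIntegrable _ _).mul_const (α s))
    rw [intervalIntegral.integral_mul_const, h2, one_mul] at h4
    simp_rw [mul_sub]
    exact h4.symm
  rw [h1, h3, ← mul_assoc, ← intervalIntegral.integral_const_mul]
  refine intervalIntegral.norm_integral_le_of_norm_le (by linarith)
    (Eventually.of_forall fun τ _ => ?_) ((hαi.sub intervalIntegrable_const).norm.const_mul _)
  rw [norm_mul, deriv_ramp, norm_div, Real.norm_of_nonneg hε.le, div_eq_mul_inv]
  gcongr
  exact hC _

/-- The difference of two ramps as a test function in time. -/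
noncomputable def rampTest {T : ℝ} (hε : 0 < ε) (hs : 0 < s) (hst : s ≤ t) (ht : t + ε < T) :
    𝓓(timeOpens T, ℝ) where
  toFun τ := ramp ε s τ - ramp ε t τ
  contDiff' := contDiff_ramp.sub contDiff_ramp
  hasCompactSupport' := HasCompactSupport.intro (K := Icc s (t + ε)) isCompact_Icc fun τ hτ => by
    rw [mem_Icc, not_and_or, not_le, not_le] at hτ
    rcases hτ with h | h
    · rw [ramp_eq_zero hε h.le, ramp_eq_zero hε (h.le.trans hst), sub_self]
    · rw [ramp_eq_one hε (by linarith), ramp_eq_one hε h.le, sub_self]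
  tsupport_subset' := by
    refine (closure_minimal (fun τ hτ => ?_) (isClosed_Icc (a := s) (b := t + ε))).trans
      fun τ hτ => ⟨hs.trans_le hτ.1, hτ.2.trans_lt ht⟩
    by_contra hτ'
    rw [mem_Icc, not_and_or, not_le, not_le] at hτ'
    refine hτ ?_
    rcases hτ' with h | h
    · simp only [ramp_eq_zero hε h.le, ramp_eq_zero hε (h.le.trans hst), sub_self]
    · simp only [ramp_eq_one hε h.le, ramp_eq_one hε ((add_le_add_left hst ε).trans h.le), sub_self]

/-- If the distributional derivative of `α` on `(0, T)` is dominated by an integrable function `b`,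
then the increments of `α` between right Lebesgue points are bounded by the integral of `b`. -/
lemma abs_sub_le_of_weak_deriv {T : ℝ} {α b : ℝ → ℝ} (hα : Integrable α) (hb : Integrable b)
    (hb0 : ∀ τ, 0 ≤ b τ)
    (h : ∀ η : 𝓓(timeOpens T, ℝ), |∫ τ, deriv η τ * α τ| ≤ ∫ τ, |η τ| * b τ)
    (hs : s ∈ Ioo 0 T) (ht : t ∈ Ioo 0 T) (hst : s ≤ t) (hsl : RightLebesguePoint α s)
    (htl : RightLebesguePoint α t) : |α t - α s| ≤ ∫ τ in s..t, b τ := by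
  have hlim : Tendsto (fun ε => ∫ τ in s..t + ε, b τ) (𝓝[>] 0) (𝓝 (∫ τ in s..t, b τ)) := by
    have h1 : Continuous fun ε => ∫ τ in s..t + ε, b τ :=
      (intervalIntegral.continuous_primitive (fun _ _ => hb.intervalIntegrable) s).comp
        (continuous_const.add continuous_id)
    have h2 := h1.tendsto 0
    rw [add_zero] at h2
    exact h2.mono_left nhdsWithin_le_nhds
  rw [abs_sub_comm]
  refine le_of_tendsto_of_tendsto
    ((tendsto_integral_deriv_ramp hα hsl).sub (tendsto_integral_deriv_ramp hα htl)).abs hlim ?_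
  filter_upwards [Ioo_mem_nhdsGT (sub_pos.2 ht.2)] with ε hε
  have hε0 : 0 < ε := hε.1
  have hεT : t + ε < T := by linarith [hε.2]
  set η := rampTest hε0 hs.1 hst hεT with hη
  have h1 : ∀ τ, η τ = ramp ε s τ - ramp ε t τ := fun _ => rfl
  have h2 : ∀ τ, deriv η τ = deriv (ramp ε s) τ - deriv (ramp ε t) τ := fun τ =>
    deriv_sub ((contDiff_ramp (n := 1)).differentiable one_ne_zero τ)
      ((contDiff_ramp (n := 1)).differentiable one_ne_zero τ)
  have h3 := h η
  simp_rw [h2, sub_mul] at h3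
  rw [integral_sub (integrable_deriv_ramp_mul hε0 hα) (integrable_deriv_ramp_mul hε0 hα)] at h3
  refine h3.trans ?_
  rw [intervalIntegral.integral_of_le (by linarith), ← integral_Icc_eq_integral_Ioc,
    ← integral_indicator measurableSet_Icc]
  refine integral_mono_of_nonneg (Eventually.of_forall fun τ => mul_nonneg (abs_nonneg _) (hb0 τ))
    (hb.indicator measurableSet_Icc) (Eventually.of_forall fun τ => ?_)
  by_cases hτ : τ ∈ Icc s (t + ε)
  · simp only [indicator_of_mem hτ]
    refine mul_le_of_le_one_left (hb0 τ) ?_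
    rw [h1, abs_le]
    have k1 := Real.smoothTransition.le_one ((τ - s) / ε)
    have k2 := Real.smoothTransition.nonneg ((τ - s) / ε)
    have k3 := Real.smoothTransition.le_one ((τ - t) / ε)
    have k4 := Real.smoothTransition.nonneg ((τ - t) / ε)
    simp only [ramp]
    constructor <;> linarith
  · simp only [indicator_of_notMem hτ]
    rw [mem_Icc, not_and_or, not_le, not_le] at hτ
    rcases hτ with hτ | hτ
    · rw [h1, ramp_eq_zero hε0 hτ.le, ramp_eq_zero hε0 (hτ.le.trans hst)]; simp
    · rw [h1, ramp_eq_one hε0 hτ.le, ramp_eq_one hε0 (by linarith)]; simp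

end Ramp

/-! ### Truncation in `W^{1,p}_0` -/

section Truncation

variable {d m : ℕ} {Ω : Opens (Eu d)} {p : ℝ≥0∞} [Fact (1 ≤ p)]

/-- A smooth compactly supported truncation of `ℝᵐ`, equal to the identity on a given ball. -/
lemma exists_smooth_truncation (m : ℕ) (M : ℝ) : ∃ S : Eu m → Eu m, ContDiff ℝ (⊤ : ℕ∞) S ∧
    (∀ y, ‖y‖ ≤ M → S y = y) ∧ (∃ C, ∀ y, ‖S y‖ ≤ C) ∧ ∃ L, ∀ y, ‖fderiv ℝ S y‖ ≤ L := by
  let χ : ContDiffBump (0 : Eu m) := ⟨|M| + 1, |M| + 2, by positivity, by linarith⟩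
  have hS : ContDiff ℝ (⊤ : ℕ∞) fun y : Eu m => χ y • y := χ.contDiff.smul contDiff_id
  have hc : HasCompactSupport fun y : Eu m => χ y • y := χ.hasCompactSupport.smul_right
  refine ⟨fun y => χ y • y, hS, fun y hy => ?_, ?_, ?_⟩
  · have : χ y = 1 := χ.one_of_mem_closedBall <| by
      rw [mem_closedBall_zero_iff]
      change ‖y‖ ≤ |M| + 1
      linarith [le_abs_self M]
    simp only [this, one_smul]
  · exact hS.continuous.bounded_above_of_compact_support hc
  · exact (hS.continuous_fderiv (by simp)).bounded_above_of_compact_support (hc.fderiv ℝ)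

/-- Composition of a test function with a smooth map fixing the origin. -/
noncomputable def testComp (S : Eu m → Eu m) (hS : ContDiff ℝ (⊤ : ℕ∞) S) (hS0 : S 0 = 0) (φ : 𝓓(Ω, Eu m)) :
    𝓓(Ω, Eu m) where
  toFun := S ∘ φ
  contDiff' := hS.comp φ.contDiff
  hasCompactSupport' := φ.hasCompactSupport.comp_left hS0
  tsupport_subset' := (closure_mono (Function.support_comp_subset hS0 _)).trans φ.tsupport_subset

lemma norm_toLp_pair_le {E F : Type*} [NormedAddCommGroup E] [NormedAddCommGroup F] (x : E)
    (y : F) : ‖WithLp.toLp p (x, y)‖ ≤ ‖x‖ + ‖y‖ := by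
  have h : WithLp.toLp p (x, y) = WithLp.toLp p (x, (0 : F)) + WithLp.toLp p ((0 : E), y) := by
    rw [← WithLp.toLp_add, Prod.mk_add_mk, add_zero, zero_add]
  rw [h]
  refine (norm_add_le _ _).trans_eq ?_
  rw [WithLp.norm_toLp_fst, WithLp.norm_toLp_snd]

/-- Composition with a smooth Lipschitz map is bounded on test functions in the norm of
`W^{1,p}_0`. -/
lemma norm_ofTest_testComp_le {S : Eu m → Eu m} (hS : ContDiff ℝ (⊤ : ℕ∞) S) (hS0 : S 0 = 0)
    {L : ℝ} (hL : ∀ x y, ‖S x - S y‖ ≤ L * ‖x - y‖) (hL' : ∀ y, ‖fderiv ℝ S y‖ ≤ L)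
    (φ : 𝓓(Ω, Eu m)) :
    ‖(W01p.ofTest (testComp S hS hS0 φ) : W01p Ω m p)‖ ≤ 2 * L * ‖testGraph Ω m p φ‖ := by
  have h0 : ‖(W01p.ofTest (testComp S hS hS0 φ) : W01p Ω m p)‖ =
      ‖testGraph Ω m p (testComp S hS hS0 φ)‖ := rfl
  rw [h0]
  refine (norm_toLp_pair_le _ _).trans ?_
  have hL0 : 0 ≤ L := (norm_nonneg _).trans (hL' 0)
  have h1 : ‖(memLp_test p (testComp S hS hS0 φ)).toLp _‖ ≤ L * ‖(memLp_test p φ).toLp _‖ := by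
    refine Lp.norm_le_mul_norm_of_ae_le_mul ?_
    filter_upwards [(memLp_test p (testComp S hS hS0 φ)).coeFn_toLp, (memLp_test p φ).coeFn_toLp]
      with x hx hx'
    rw [hx, hx']
    have := hL (φ x) 0
    rwa [hS0, sub_zero, sub_zero] at this
  have h2 : ‖(memLp_fderiv_test p (testComp S hS hS0 φ)).toLp _‖ ≤
      L * ‖(memLp_fderiv_test p φ).toLp _‖ := by
    refine Lp.norm_le_mul_norm_of_ae_le_mul ?_
    filter_upwards [(memLp_fderiv_test p (testComp S hS hS0 φ)).coeFn_toLp,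
      (memLp_fderiv_test p φ).coeFn_toLp] with x hx hx'
    rw [hx, hx']
    have h3 : fderiv ℝ (testComp S hS hS0 φ) x = (fderiv ℝ S (φ x)).comp (fderiv ℝ φ x) :=
      fderiv_comp x (hS.differentiable (by simp) _) (φ.contDiff.differentiable (by simp) x)
    rw [h3]
    refine (ContinuousLinearMap.opNorm_comp_le _ _).trans ?_
    gcongr
    exact hL' _
  have h3 : ‖(memLp_test p φ).toLp _‖ ≤ ‖testGraph Ω m p φ‖ :=
    WithLp.norm_fst_le _ (testGraph Ω m p φ)
  have h4 : ‖(memLp_fderiv_test p φ).toLp _‖ ≤ ‖testGraph Ω m p φ‖ :=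
    WithLp.norm_snd_le _ (testGraph Ω m p φ)
  nlinarith

/-- A bounded element of `W^{1,p}_0` is the limit in `L^p` of test functions which are uniformly
bounded, with `W^{1,p}_0` norms bounded by a multiple of its own.  The truncation is applied to
test functions approximating `w`, so that no chain rule for weak derivatives is needed. -/
lemma exists_bounded_test_approx (Ω : Opens (Eu d)) (m : ℕ) (p : ℝ≥0∞) [Fact (1 ≤ p)] (M : ℝ) :
    ∃ C L : ℝ, 0 ≤ C ∧ 0 ≤ L ∧ ∀ w : W01p Ω m p, (∀ᵐ x ∂(volOn Ω), ‖W01p.val w x‖ ≤ M) →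
      ∀ ε > 0, ∃ φ : 𝓓(Ω, Eu m), (∀ x, ‖φ x‖ ≤ C) ∧
        ‖(W01p.ofTest φ : W01p Ω m p)‖ ≤ L * (‖w‖ + ε) ∧
        ‖(memLp_test p φ).toLp _ - W01p.val w‖ ≤ L * ε := by
  obtain ⟨S, hS, hSid, ⟨C, hC⟩, L, hL'⟩ := exists_smooth_truncation m (max M 0)
  have hS0 : S 0 = 0 := hSid 0 (by simp)
  have hL : ∀ x y, ‖S x - S y‖ ≤ L * ‖x - y‖ := fun x y =>
    convex_univ.norm_image_sub_le_of_norm_fderiv_le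
      (fun z _ => hS.differentiable (by simp) z) (fun z _ => hL' z) (mem_univ y) (mem_univ x)
  have hL0 : 0 ≤ L := (norm_nonneg _).trans (hL' 0)
  refine ⟨C, 2 * L, (norm_nonneg _).trans (hC 0), by positivity, fun w hw ε hε => ?_⟩
  have hw' : (Subtype.val (p := (· ∈ W01pSubmodule Ω m p)) w) ∈
      closure (LinearMap.range (testGraph Ω m p) : Set (LpPair Ω m p)) :=
    Subtype.prop (p := (· ∈ W01pSubmodule Ω m p)) w
  obtain ⟨_, ⟨φ, rfl⟩, hφ⟩ := Metric.mem_closure_iff.1 hw' ε hε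
  rw [dist_comm, dist_eq_norm] at hφ
  have hwn : ‖w‖ = ‖Subtype.val (p := (· ∈ W01pSubmodule Ω m p)) w‖ := rfl
  refine ⟨testComp S hS hS0 φ, fun x => hC _, ?_, ?_⟩
  · refine (norm_ofTest_testComp_le hS hS0 hL hL' φ).trans ?_
    gcongr
    rw [hwn]
    have := norm_add_le (Subtype.val (p := (· ∈ W01pSubmodule Ω m p)) w)
      (testGraph Ω m p φ - Subtype.val (p := (· ∈ W01pSubmodule Ω m p)) w)
    rw [add_sub_cancel] at this
    linarith
  · have h1 : ‖(memLp_test p φ).toLp _ - W01p.val w‖ ≤ ε :=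
      (WithLp.norm_fst_le _ (testGraph Ω m p φ -
        Subtype.val (p := (· ∈ W01pSubmodule Ω m p)) w)).trans hφ.le
    have h2 : ‖(memLp_test p (testComp S hS hS0 φ)).toLp _ - W01p.val w‖ ≤
        L * ‖(memLp_test p φ).toLp _ - W01p.val w‖ := by
      refine Lp.norm_le_mul_norm_of_ae_le_mul ?_
      filter_upwards [(memLp_test p (testComp S hS hS0 φ)).coeFn_toLp,
        (memLp_test p φ).coeFn_toLp, hw,
        Lp.coeFn_sub ((memLp_test p (testComp S hS hS0 φ)).toLp _) (W01p.val w),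
        Lp.coeFn_sub ((memLp_test p φ).toLp _) (W01p.val w)] with x hx hx' hxM h3 h4
      rw [h3, h4, Pi.sub_apply, Pi.sub_apply, hx, hx']
      have := hL (φ x) (W01p.val w x)
      rwa [hSid _ (hxM.trans (le_max_left _ _))] at this
    nlinarith

end Truncation

/-! ### Comparison of Lebesgue spaces over a finite measure -/

section Inclusion

variable {X Y E : Type*} [MeasurableSpace X] [MeasurableSpace Y] [NormedAddCommGroup E]
  {μ : Measure X} {ν : Measure Y} [IsFiniteMeasure ν] {p q : ℝ≥0∞}

lemma exists_eLpNorm_toReal_le (E : Type*) [NormedAddCommGroup E] (ν : Measure Y)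
    [IsFiniteMeasure ν] (hp0 : p ≠ 0) (hpq : p ≤ q) :
    ∃ c : ℝ, 0 ≤ c ∧ ∀ f : Lp E q ν, (eLpNorm f p ν).toReal ≤ c * ‖f‖ := by
  have hc : ν univ ^ (1 / p.toReal - 1 / q.toReal) ≠ ∞ := by
    refine ENNReal.rpow_ne_top_of_nonneg ?_ (measure_ne_top ν univ)
    rcases eq_or_ne q ∞ with rfl | hq
    · simp
    · exact sub_nonneg.2 (one_div_le_one_div_of_le
        (ENNReal.toReal_pos hp0 (ne_top_of_le_ne_top hq hpq)) (ENNReal.toReal_mono hq hpq))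
  refine ⟨(ν univ ^ (1 / p.toReal - 1 / q.toReal)).toReal, ENNReal.toReal_nonneg, fun f => ?_⟩
  rw [Lp.norm_def, mul_comm, ← ENNReal.toReal_mul]
  exact ENNReal.toReal_mono (ENNReal.mul_ne_top (Lp.eLpNorm_ne_top f) hc)
    (eLpNorm_le_eLpNorm_mul_rpow_measure_univ hpq (Lp.aestronglyMeasurable f))

/-- Strong measurability in `L^q` follows from strong measurability in the weaker norm of `L^p`:
the inclusion of the Polish space `L^q` is continuous and injective, hence a measurable
embedding. -/
lemma aestronglyMeasurable_of_inclusion [Fact (1 ≤ p)] [Fact (1 ≤ q)] [Fact (q ≠ ∞)]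
    [MeasureTheory.IsSeparable ν] [SeparableSpace E] [CompleteSpace E] (hpq : p ≤ q)
    {v : X → Lp E q ν} {w : X → Lp E p ν} (hw : AEStronglyMeasurable w μ)
    (h : ∀ᵐ x ∂μ, v x =ᵐ[ν] w x) : AEStronglyMeasurable v μ := by
  let _ : MeasurableSpace (Lp E p ν) := borel _
  have _ : BorelSpace (Lp E p ν) := ⟨rfl⟩
  let _ : MeasurableSpace (Lp E q ν) := borel _
  have _ : BorelSpace (Lp E q ν) := ⟨rfl⟩
  let ι : Lp E q ν →+ Lp E p ν := AddSubgroup.inclusion (Lp.antitone hpq)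
  obtain ⟨c, -, hc⟩ := exists_eLpNorm_toReal_le E ν
    (zero_lt_one.trans_le (Fact.out : 1 ≤ p)).ne' hpq
  have hι : Continuous ι := AddMonoidHomClass.continuous_of_bound ι c fun f => by
    rw [Lp.norm_def]; exact hc f
  have hemb : MeasurableEmbedding ι :=
    hι.measurableEmbedding (AddSubgroup.inclusion_injective (Lp.antitone hpq))
  have hιv : ι ∘ v =ᵐ[μ] w := by
    filter_upwards [h] with x hx
    exact Lp.ext hx
  exact (hemb.aemeasurable_comp_iff.1 (hw.aemeasurable.congr hιv.symm)).aestronglyMeasurable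

end Inclusion

/-! ### Norms of the components of the time derivative -/

section TimeNorms

variable {d m : ℕ} {Ω : Opens (Eu d)} {p : ℝ≥0∞} {T : ℝ}

/-- The `L¹(Ω)` norm of the slice of `f`, extended by zero in time. -/
noncomputable def sliceL1 (f : Lp (Eu m) p (volCyl T Ω)) : ℝ → ℝ :=
  (Ioo 0 T).indicator fun t => ∫ x, ‖f (t, x)‖ ∂(volOn Ω)

lemma sliceL1_nonneg (f : Lp (Eu m) p (volCyl T Ω)) (t : ℝ) : 0 ≤ sliceL1 f t :=
  indicator_nonneg (fun _ _ => integral_nonneg fun _ => norm_nonneg _) t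

variable [Fact (1 ≤ p)]

/-- The dual norm of the value of `g`, extended by zero in time. -/
noncomputable def dualNorm (g : Lp (Wneg Ω m p) p.conjExponent (volTime T)) : ℝ → ℝ :=
  (Ioo 0 T).indicator fun t => ‖g t‖

lemma dualNorm_nonneg (g : Lp (Wneg Ω m p) p.conjExponent (volTime T)) (t : ℝ) :
    0 ≤ dualNorm g t :=
  indicator_nonneg (fun _ _ => norm_nonneg _) t

lemma integrable_dualNorm (g : Lp (Wneg Ω m p) p.conjExponent (volTime T)) :
    Integrable (dualNorm g) := by
  rw [dualNorm, integrable_indicator_iff measurableSet_Ioo]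
  exact ((Lp.memLp g).integrable (ENNReal.HolderConjugate.symm (p := p)).one_le).norm

variable [IsFiniteMeasure (volOn Ω)]

lemma integrable_Lp_cyl (f : Lp (Eu m) p (volCyl T Ω)) :
    Integrable f ((volTime T).prod (volOn Ω)) := by
  rw [← volCyl_eq]
  have : IsFiniteMeasure (volCyl T Ω) := by rw [volCyl_eq]; infer_instance
  exact (Lp.memLp f).integrable Fact.out

lemma integrable_sliceL1 (f : Lp (Eu m) p (volCyl T Ω)) : Integrable (sliceL1 f) := by
  rw [sliceL1, integrable_indicator_iff measurableSet_Ioo]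
  exact (integrable_Lp_cyl f).norm.integral_prod_left

end TimeNorms

/-! ### Time slices in `L²` -/

section Slices

variable {d m : ℕ} {Ω : Opens (Eu d)} {p : ℝ≥0∞} [Fact (1 ≤ p)] {T : ℝ}

lemma continuous_val : Continuous (W01p.val : W01p Ω m p → Lp (Eu m) p (volOn Ω)) := by
  refine AddMonoidHomClass.continuous_of_bound W01p.val 1 fun w => ?_
  rw [one_mul]
  exact WithLp.norm_fst_le _ (Subtype.val (p := (· ∈ W01pSubmodule Ω m p)) w)

lemma ae_norm_le_norm (u : Lp (Eu m) ∞ (volCyl T Ω)) :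
    ∀ᵐ t ∂(volTime T), ∀ᵐ x ∂(volOn Ω), ‖u (t, x)‖ ≤ ‖u‖ := by
  refine Measure.ae_ae_of_ae_prod (p := fun z => ‖u z‖ ≤ ‖u‖) ?_
  rw [← volCyl_eq]
  filter_upwards [ae_le_eLpNormEssSup (f := u) (μ := volCyl T Ω)] with z hz
  rw [Lp.norm_def, eLpNorm_exponent_top, ← toReal_enorm]
  exact ENNReal.toReal_mono (by simpa using Lp.eLpNorm_ne_top u) hz

/-- The times in `(0, T)` at which the value of `U` is the slice of `u` and is bounded by the
`L^∞` norm of `u`. -/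
def goodTimes (u : Lp (Eu m) ∞ (volCyl T Ω)) (U : Lp (W01p Ω m p) p (volTime T)) : Set ℝ :=
  {t | t ∈ Ioo 0 T ∧ (∀ᵐ x ∂(volOn Ω), ‖W01p.val (U t) x‖ ≤ ‖u‖) ∧
    ∀ᵐ x ∂(volOn Ω), W01p.val (U t) x = u (t, x)}

variable {u : Lp (Eu m) ∞ (volCyl T Ω)} {U : Lp (W01p Ω m p) p (volTime T)}

lemma IsSlices.ae_mem_goodTimes (hU : IsSlices u U) : ∀ᵐ t ∂(volTime T), t ∈ goodTimes u U := by
  filter_upwards [hU, ae_norm_le_norm u, ae_restrict_mem measurableSet_Ioo] with t h1 h2 h3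
  refine ⟨h3, ?_, h1⟩
  filter_upwards [h1, h2] with x h4 h5
  rw [h4]
  exact h5

variable [IsFiniteMeasure (volOn Ω)]

lemma memLp_val_of_mem_goodTimes {t : ℝ} (ht : t ∈ goodTimes u U) :
    MemLp (W01p.val (U t)) 2 (volOn Ω) :=
  MemLp.of_bound (Lp.aestronglyMeasurable _) ‖u‖ ht.2.1

open Classical in
/-- The slice `u(t, ·)` as an element of `L²(Ω)`, set to `0` outside the good times. -/
noncomputable def slice (u : Lp (Eu m) ∞ (volCyl T Ω)) (U : Lp (W01p Ω m p) p (volTime T))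
    (t : ℝ) : Lp (Eu m) 2 (volOn Ω) :=
  if ht : t ∈ goodTimes u U then (memLp_val_of_mem_goodTimes ht).toLp _ else 0

lemma coeFn_slice {t : ℝ} (ht : t ∈ goodTimes u U) : slice u U t =ᵐ[volOn Ω] W01p.val (U t) := by
  rw [slice, dif_pos ht]
  exact MemLp.coeFn_toLp _

lemma slice_of_notMem {t : ℝ} (ht : t ∉ goodTimes u U) : slice u U t = 0 := dif_neg ht

lemma ae_norm_slice_le (t : ℝ) : ∀ᵐ x ∂(volOn Ω), ‖slice u U t x‖ ≤ ‖u‖ := by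
  by_cases ht : t ∈ goodTimes u U
  · filter_upwards [coeFn_slice ht, ht.2.1] with x h1 h2
    rwa [h1]
  · rw [slice_of_notMem ht]
    filter_upwards [Lp.coeFn_zero (Eu m) 2 (volOn Ω)] with x hx
    rw [hx, Pi.zero_apply, norm_zero]
    exact norm_nonneg _

lemma norm_slice_le (t : ℝ) :
    ‖slice u U t‖ ≤ (measureUnivNNReal (volOn Ω) : ℝ) ^ (2 : ℝ≥0∞).toReal⁻¹ * ‖u‖ :=
  Lp.norm_le_of_ae_bound (norm_nonneg u) (ae_norm_slice_le t)

lemma integrable_slice (hp : p ≤ 2) (hU : IsSlices u U) : Integrable (slice u U) := by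
  have h0 : slice u U = (Ioo 0 T).indicator (slice u U) := by
    ext1 t
    by_cases ht : t ∈ Ioo 0 T
    · rw [indicator_of_mem ht]
    · rw [indicator_of_notMem ht, slice_of_notMem fun h => ht h.1]
  have : Fact ((2 : ℝ≥0∞) ≠ ∞) := ⟨ENNReal.ofNat_ne_top⟩
  have hm : AEStronglyMeasurable (slice u U) (volTime T) := by
    refine aestronglyMeasurable_of_inclusion hp
      (continuous_val.comp_aestronglyMeasurable (Lp.aestronglyMeasurable U)) ?_
    filter_upwards [hU.ae_mem_goodTimes] with t ht using coeFn_slice ht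
  rw [h0, integrable_indicator_iff measurableSet_Ioo]
  exact Integrable.of_bound hm _ (Eventually.of_forall norm_slice_le)

/-- The `L²` class of a test function. -/
noncomputable abbrev testL2 (φ : 𝓓(Ω, Eu m)) : Lp (Eu m) 2 (volOn Ω) := (memLp_test 2 φ).toLp _

lemma inner_slice_testL2 {t : ℝ} (ht : t ∈ goodTimes u U) (φ : 𝓓(Ω, Eu m)) :
    inner ℝ (slice u U t) (testL2 φ) = ∫ x, inner ℝ (u (t, x)) (φ x) ∂(volOn Ω) := by
  rw [L2.inner_def]
  refine integral_congr_ae ?_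
  filter_upwards [coeFn_slice ht, ht.2.2, (memLp_test 2 φ).coeFn_toLp] with x h1 h2 h3
  rw [h1, h2, h3]

/-! ### The weak time derivative of the slices -/

/-- Against a bounded test function `φ`, the distributional derivative of `t ↦ ⟪u(t), φ⟫` is
dominated by an integrable function of time. -/
lemma HasTimeDeriv.abs_integral_deriv_mul_le {f : Lp (Eu m) p (volCyl T Ω)}
    {g : Lp (Wneg Ω m p) p.conjExponent (volTime T)} (h : HasTimeDeriv u f g) (hU : IsSlices u U)
    {C : ℝ} (φ : 𝓓(Ω, Eu m)) (hφ : ∀ x, ‖φ x‖ ≤ C) (η : 𝓓(timeOpens T, ℝ)) :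
    |∫ t, deriv η t * inner ℝ (slice u U t) (testL2 φ)| ≤
      ∫ t, |η t| * (C * sliceL1 f t + ‖(W01p.ofTest φ : W01p Ω m p)‖ * dualNorm g t) := by
  have e1 : ∫ t, deriv η t * inner ℝ (slice u U t) (testL2 φ) =
      ∫ z, deriv η z.1 * inner ℝ (u z) (φ z.2) ∂(volCyl T Ω) := by
    have hi : Integrable (fun z : ℝ × Eu d => deriv η z.1 * inner ℝ (u z) (φ z.2))
        ((volTime T).prod (volOn Ω)) := by
      rw [← volCyl_eq]
      exact integrable_cyl u (continuous_deriv_test η) η.hasCompactSupport.deriv φ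
    have hprod : ∫ z, deriv η z.1 * inner ℝ (u z) (φ z.2) ∂(volCyl T Ω) =
        ∫ z : ℝ × Eu d, deriv η z.1 * inner ℝ (u z) (φ z.2) ∂((volTime T).prod (volOn Ω)) := by
      rw [← volCyl_eq]
    rw [← setIntegral_eq_integral_of_forall_compl_eq_zero (s := Ioo 0 T) fun t ht => by
      rw [slice_of_notMem fun h => ht h.1, inner_zero_left, mul_zero]]
    rw [hprod, integral_prod _ hi]
    refine integral_congr_ae ?_
    filter_upwards [hU.ae_mem_goodTimes] with t ht
    rw [inner_slice_testL2 ht, integral_const_mul]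
  obtain ⟨N, hN⟩ := η.continuous.bounded_above_of_compact_support η.hasCompactSupport
  have hC : 0 ≤ C := (norm_nonneg _).trans (hφ 0)
  have hηf : Integrable (fun z : ℝ × Eu d => |η z.1| * (C * ‖f z‖))
      ((volTime T).prod (volOn Ω)) := by
    refine ((integrable_Lp_cyl f).norm.const_mul C).bdd_mul (c := N)
      (η.continuous.comp continuous_fst).abs.aestronglyMeasurable (Eventually.of_forall fun z => ?_)
    rw [Real.norm_eq_abs, abs_abs]
    exact hN _
  have e2 : |∫ z, η z.1 * inner ℝ (f z) (φ z.2) ∂(volCyl T Ω)| ≤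
      ∫ t, |η t| * (C * sliceL1 f t) := by
    have h1 : ∫ t, |η t| * (C * sliceL1 f t) =
        ∫ z : ℝ × Eu d, |η z.1| * (C * ‖f z‖) ∂((volTime T).prod (volOn Ω)) := by
      rw [integral_prod _ hηf,
        ← setIntegral_eq_integral_of_forall_compl_eq_zero (s := Ioo 0 T) fun t ht => by
          rw [sliceL1, indicator_of_notMem ht, mul_zero, mul_zero]]
      refine setIntegral_congr_fun measurableSet_Ioo fun t ht => ?_
      simp only [sliceL1, indicator_of_mem ht, integral_const_mul]
    rw [h1, ← Real.norm_eq_abs, ← volCyl_eq]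
    rw [← volCyl_eq] at hηf
    refine norm_integral_le_of_norm_le hηf (Eventually.of_forall fun z => ?_)
    rw [norm_mul, Real.norm_eq_abs]
    refine mul_le_mul_of_nonneg_left ((norm_inner_le_norm _ _).trans ?_) (abs_nonneg _)
    rw [mul_comm C]
    exact mul_le_mul_of_nonneg_left (hφ _) (norm_nonneg _)
  have hηb : ∀ {b : ℝ → ℝ}, Integrable b → Integrable fun t => |η t| * b t := fun hb =>
    hb.bdd_mul (c := N) η.continuous.abs.aestronglyMeasurable (Eventually.of_forall fun t => by
      rw [Real.norm_eq_abs, abs_abs]; exact hN t)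
  have hi1 := hηb ((integrable_sliceL1 f).const_mul C)
  have hi2 := hηb ((integrable_dualNorm g).const_mul ‖(W01p.ofTest φ : W01p Ω m p)‖)
  have e3 : |∫ t, η t * g t (W01p.ofTest φ) ∂(volTime T)| ≤
      ∫ t, |η t| * (‖(W01p.ofTest φ : W01p Ω m p)‖ * dualNorm g t) := by
    have h1 : ∫ t, |η t| * (‖(W01p.ofTest φ : W01p Ω m p)‖ * dualNorm g t) =
        ∫ t in Ioo 0 T, |η t| * (‖(W01p.ofTest φ : W01p Ω m p)‖ * dualNorm g t) :=
      (setIntegral_eq_integral_of_forall_compl_eq_zero fun t ht => by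
        rw [dualNorm, indicator_of_notMem ht, mul_zero, mul_zero]).symm
    rw [h1, ← Real.norm_eq_abs]
    refine norm_integral_le_of_norm_le hi2.integrableOn ?_
    filter_upwards [ae_restrict_mem measurableSet_Ioo] with t ht
    rw [norm_mul, Real.norm_eq_abs, dualNorm, indicator_of_mem ht, mul_comm ‖W01p.ofTest φ‖]
    exact mul_le_mul_of_nonneg_left ((g t).le_opNorm _) (abs_nonneg _)
  simp_rw [mul_add]
  rw [integral_add hi1 hi2, e1, ← abs_neg, h η φ]
  exact (abs_add_le _ _).trans (add_le_add e2 e3)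

/-- The weak formulation tested with a slice of `u`.  Slices are bounded elements of `W^{1,p}_0`,
so they are limits of test functions bounded both uniformly and in `W^{1,p}_0`. -/
lemma HasTimeDeriv.exists_abs_inner_le (hp : p ≤ 2) {f : Lp (Eu m) p (volCyl T Ω)}
    {g : Lp (Wneg Ω m p) p.conjExponent (volTime T)} (h : HasTimeDeriv u f g)
    (hU : IsSlices u U) : ∃ C L : ℝ, 0 ≤ C ∧ 0 ≤ L ∧
      ∀ s ∈ goodTimes u U, ∀ t ∈ goodTimes u U, ∀ r ∈ goodTimes u U, s ≤ t →
        RightLebesguePoint (slice u U) s → RightLebesguePoint (slice u U) t →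
        |inner ℝ (slice u U t - slice u U s) (slice u U r)| ≤
          C * (∫ τ in s..t, sliceL1 f τ) + L * ‖U r‖ * ∫ τ in s..t, dualNorm g τ := by
  obtain ⟨C, L, hC, hL, happrox⟩ := exists_bounded_test_approx Ω m p ‖u‖
  obtain ⟨c, hc, hcp⟩ := exists_eLpNorm_toReal_le (Eu m) (volOn Ω) one_ne_zero
    (Fact.out : 1 ≤ p)
  refine ⟨C, L, hC, hL, fun s hs t ht r hr hst hsl htl => ?_⟩
  set v := slice u U with hv
  have hvi : Integrable v := integrable_slice hp hU
  set I := ∫ τ in s..t, sliceL1 f τ with hI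
  set J := ∫ τ in s..t, dualNorm g τ with hJ
  have hJ0 : 0 ≤ J := intervalIntegral.integral_nonneg hst fun τ _ => dualNorm_nonneg g τ
  have hε : ∀ ε > 0, |inner ℝ (v t - v s) (v r)| ≤
      C * I + L * (‖U r‖ + ε) * J + 2 * ‖u‖ * (c * (L * ε)) := by
    intro ε hε
    obtain ⟨φ, hφC, hφW, hφp⟩ := happrox (U r) hr.2.1 ε hε
    have hα : Integrable fun τ => inner ℝ (v τ) (testL2 φ) := hvi.inner_const _
    have hαle : ∀ τ' τ, ‖inner ℝ (v τ) (testL2 φ) - inner ℝ (v τ') (testL2 φ)‖ ≤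
        ‖testL2 φ‖ * ‖v τ - v τ'‖ := fun τ' τ => by
      rw [← inner_sub_left, mul_comm]
      exact norm_inner_le_norm _ _
    have h1 := abs_sub_le_of_weak_deriv (T := T)
      (b := fun τ => C * sliceL1 f τ + ‖(W01p.ofTest φ : W01p Ω m p)‖ * dualNorm g τ) hα
      (((integrable_sliceL1 f).const_mul C).add
        ((integrable_dualNorm g).const_mul ‖(W01p.ofTest φ : W01p Ω m p)‖))
      (fun τ => add_nonneg (mul_nonneg hC (sliceL1_nonneg f τ))
        (mul_nonneg (norm_nonneg _) (dualNorm_nonneg g τ)))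
      (fun η => h.abs_integral_deriv_mul_le hU φ hφC η) hs.1 ht.1 hst
      (hsl.of_norm_le hvi.locallyIntegrable hα.locallyIntegrable (hαle s))
      (htl.of_norm_le hvi.locallyIntegrable hα.locallyIntegrable (hαle t))
    rw [intervalIntegral.integral_add ((integrable_sliceL1 f).const_mul C).intervalIntegrable
      ((integrable_dualNorm g).const_mul _).intervalIntegrable,
      intervalIntegral.integral_const_mul, intervalIntegral.integral_const_mul,
      ← inner_sub_left] at h1
    have h2 : |inner ℝ (v t - v s) (testL2 φ - v r)| ≤ 2 * ‖u‖ * (c * (L * ε)) := by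
      set e : Lp (Eu m) p (volOn Ω) := (memLp_test p φ).toLp _ - W01p.val (U r) with he
      have hei : Integrable e (volOn Ω) := (Lp.memLp e).integrable Fact.out
      have h3 : ∫ x, ‖e x‖ ∂(volOn Ω) ≤ c * (L * ε) := by
        rw [integral_norm_eq_lintegral_enorm hei.1, ← eLpNorm_one_eq_lintegral_enorm]
        exact (hcp e).trans (mul_le_mul_of_nonneg_left hφp hc)
      rw [L2.inner_def, ← Real.norm_eq_abs]
      refine (norm_integral_le_of_norm_le (hei.norm.const_mul (2 * ‖u‖)) ?_).trans ?_
      · filter_upwards [ae_norm_slice_le (u := u) (U := U) t, ae_norm_slice_le (u := u) (U := U) s,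
          Lp.coeFn_sub (v t) (v s), Lp.coeFn_sub (testL2 φ) (v r),
          (memLp_test 2 φ).coeFn_toLp, (memLp_test p φ).coeFn_toLp, coeFn_slice hr,
          Lp.coeFn_sub ((memLp_test p φ).toLp _) (W01p.val (U r))] with x k1 k2 k3 k4 k5 k6 k7 k8
        refine (norm_inner_le_norm _ _).trans ?_
        rw [k3, k4, he, k8, Pi.sub_apply, Pi.sub_apply, Pi.sub_apply, k5, k6, hv, k7]
        refine mul_le_mul_of_nonneg_right ((norm_sub_le _ _).trans ?_) (norm_nonneg _)
        linarith
      · rw [integral_const_mul]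
        exact mul_le_mul_of_nonneg_left h3 (by positivity)
    have h4 : inner ℝ (v t - v s) (v r) =
        inner ℝ (v t - v s) (testL2 φ) - inner ℝ (v t - v s) (testL2 φ - v r) := by
      rw [← inner_sub_right, sub_sub_cancel]
    rw [h4]
    refine (abs_sub _ _).trans (add_le_add (h1.trans ?_) h2)
    gcongr
  have hlim : Tendsto (fun ε => C * I + L * (‖U r‖ + ε) * J + 2 * ‖u‖ * (c * (L * ε))) (𝓝[>] 0)
      (𝓝 (C * I + L * ‖U r‖ * J)) := by
    have h1 : Continuous fun ε => C * I + L * (‖U r‖ + ε) * J + 2 * ‖u‖ * (c * (L * ε)) := by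
      fun_prop
    have h2 := h1.tendsto 0
    simp only [add_zero, mul_zero] at h2
    exact h2.mono_left nhdsWithin_le_nhds
  refine ge_of_tendsto hlim ?_
  filter_upwards [self_mem_nhdsWithin] with ε hε' using hε ε hε'

/-! ### The continuous representative -/

/-- Young's inequality turns the product of the dual norm of `g` in `L^{p'}(0,T)` and the norm of
`U` in `L^p(0,T)` into a sum of integrable functions of one time variable each. -/
lemma exists_continuous_representative (hp₁ : 1 < p) (hp₂ : p < 2) (hT : 0 < T)
    (hU : IsSlices u U) {f : Lp (Eu m) p (volCyl T Ω)}
    {g : Lp (Wneg Ω m p) p.conjExponent (volTime T)} (h : HasTimeDeriv u f g) :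
    ∃ v : CTimeL2 Ω m T, IsContRep u v ∧
      ‖v‖ ≤ (measureUnivNNReal (volOn Ω) : ℝ) ^ (2 : ℝ≥0∞).toReal⁻¹ * ‖u‖ := by
  obtain ⟨C, L, hC, hL, hCL⟩ := h.exists_abs_inner_le hp₂.le hU
  have hptop : p ≠ ∞ := (hp₂.trans ENNReal.ofNat_lt_top).ne
  have hqtop : p.conjExponent ≠ ∞ := by
    rw [ENNReal.conjExponent]
    simp [tsub_eq_zero_iff_le, hp₁]
  set P := p.toReal with hP
  set Q := p.conjExponent.toReal with hQ
  have hPQ : P.HolderConjugate Q := ENNReal.HolderConjugate.toReal_of_ne_top hptop hqtop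
  have hP1 : 1 ≤ P := hPQ.lt.le
  have hQ1 : 1 ≤ Q := hPQ.symm.lt.le
  set v := slice u U with hv
  have hvi : Integrable v := integrable_slice hp₂.le hU
  set G : ℝ → ℝ := fun t => (dualNorm g t) ^ Q with hG
  have hG0 : ∀ t, 0 ≤ G t := fun t => Real.rpow_nonneg (dualNorm_nonneg g t) _
  have hGi : Integrable G := by
    have h1 : G = (Ioo 0 T).indicator fun t => ‖g t‖ ^ Q := by
      ext1 t
      by_cases ht : t ∈ Ioo 0 T
      · simp only [hG, dualNorm, indicator_of_mem ht]
      · simp only [hG, dualNorm, indicator_of_notMem ht, Real.zero_rpow (by linarith : Q ≠ 0)]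
    rw [h1, integrable_indicator_iff measurableSet_Ioo]
    exact (Lp.memLp g).integrable_norm_rpow (by intro h0; simp [hQ, h0] at hQ1; linarith) hqtop
  set N : ℝ → ℝ := (Ioo 0 T).indicator fun t => ‖U t‖ ^ P with hN
  have hN0 : ∀ t, 0 ≤ N t := indicator_nonneg fun t _ => Real.rpow_nonneg (norm_nonneg _) _
  have hNi : Integrable N := by
    rw [hN, integrable_indicator_iff measurableSet_Ioo]
    exact (Lp.memLp U).integrable_norm_rpow (zero_lt_one.trans hp₁).ne' hptop
  set K : ℝ → ℝ := fun t => (C * sliceL1 f t + L * G t) + L * N t with hK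
  have hAi : Integrable fun t => C * sliceL1 f t + L * G t :=
    ((integrable_sliceL1 f).const_mul C).add (hGi.const_mul L)
  have hKi : Integrable K := hAi.add (hNi.const_mul L)
  have hA0 : ∀ t, 0 ≤ C * sliceL1 f t + L * G t := fun t =>
    add_nonneg (mul_nonneg hC (sliceL1_nonneg f t)) (mul_nonneg hL (hG0 t))
  have hK0 : ∀ t, 0 ≤ K t := fun t => add_nonneg (hA0 t) (mul_nonneg hL (hN0 t))
  let D : Set ℝ := {t | t ∈ goodTimes u U ∧ RightLebesguePoint v t}
  have hDT : D ⊆ Ioo 0 T := fun t ht => ht.1.1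
  have hD : ∀ᵐ t, t ∈ Ioo 0 T → t ∈ D := by
    filter_upwards [ae_rightLebesguePoint hvi.locallyIntegrable,
      (ae_restrict_iff' measurableSet_Ioo).1 hU.ae_mem_goodTimes] with t h1 h2 h3
    exact ⟨h2 h3, h1⟩
  have henergy : ∀ s ∈ D, ∀ t ∈ D, ∀ r ∈ D, s ≤ t →
      |inner ℝ (v t - v s) (v r)| ≤ (∫ τ in s..t, K τ) + (t - s) * K r := by
    intro s hs t ht r hr hst
    refine (hCL s hs.1 t ht.1 r hr.1 hst hs.2 ht.2).trans ?_
    have hyoung : ‖U r‖ * ∫ τ in s..t, dualNorm g τ ≤ (∫ τ in s..t, G τ) + (t - s) * N r := by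
      have h1 : ∫ τ in s..t, ‖U r‖ * dualNorm g τ ≤ ∫ τ in s..t, (G τ + N r) := by
        refine intervalIntegral.integral_mono hst
          ((integrable_dualNorm g).const_mul _).intervalIntegrable
          (hGi.intervalIntegrable.add intervalIntegrable_const) fun τ => ?_
        have h2 := Real.young_inequality_of_nonneg (norm_nonneg (U r)) (dualNorm_nonneg g τ) hPQ
        -- the factors `1 / P` and `1 / Q` play no role and are dropped
        have h3 : ‖U r‖ ^ P / P ≤ ‖U r‖ ^ P :=
          div_le_self (Real.rpow_nonneg (norm_nonneg _) _) hP1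
        have h4 : dualNorm g τ ^ Q / Q ≤ dualNorm g τ ^ Q := div_le_self (hG0 τ) hQ1
        have h5 : N r = ‖U r‖ ^ P := indicator_of_mem (hDT hr) _
        simp only [hG, h5]
        linarith
      rwa [intervalIntegral.integral_const_mul,
        intervalIntegral.integral_add hGi.intervalIntegrable intervalIntegrable_const,
        intervalIntegral.integral_const, smul_eq_mul] at h1
    have hKint : ∫ τ in s..t, K τ = C * (∫ τ in s..t, sliceL1 f τ) + L * (∫ τ in s..t, G τ) +
        L * ∫ τ in s..t, N τ := by
      rw [← intervalIntegral.integral_const_mul, ← intervalIntegral.integral_const_mul,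
        ← intervalIntegral.integral_const_mul, ← intervalIntegral.integral_add
          ((integrable_sliceL1 f).const_mul C).intervalIntegrable
          (hGi.const_mul L).intervalIntegrable,
        ← intervalIntegral.integral_add hAi.intervalIntegrable (hNi.const_mul L).intervalIntegrable]
    have h1 : 0 ≤ ∫ τ in s..t, N τ := intervalIntegral.integral_nonneg hst fun τ _ => hN0 τ
    have h2 := mul_le_mul_of_nonneg_left hyoung hL
    have h3 := mul_nonneg (sub_nonneg.2 hst) (hA0 r)
    have h4 := mul_nonneg hL h1
    rw [hKint]
    simp only [hK]
    linarith
  obtain ⟨w, hw, hwR⟩ := exists_continuous_of_inner_le hT hvi norm_slice_le hKi hK0 hDT hD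
    (fun t ht => ht.2) henergy
  refine ⟨w, ?_, (ContinuousMap.norm_le _ ((norm_nonneg _).trans (norm_slice_le (u := u) (U := U) 0))).2 hwR⟩
  filter_upwards [ae_restrict_of_ae hD, ae_restrict_mem measurableSet_Ioo] with t h1 h2 ht
  have h3 := h1 h2
  rw [hw t h3 ht]
  filter_upwards [coeFn_slice h3.1, h3.1.2.2] with x h4 h5
  rw [hv, h4, h5]

end Slices

section Representative

variable {d m : ℕ} {Ω : Opens (Eu d)} {T : ℝ} {u u' : Lp (Eu m) ∞ (volCyl T Ω)}
  {v v' : CTimeL2 Ω m T}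

lemma IsContRep.unique (hT : 0 < T) (h : IsContRep u v) (h' : IsContRep u v') : v = v' := by
  have hD : ∀ᵐ t, t ∈ Ioo 0 T → t ∈ {t | ∀ ht : t ∈ Icc (0 : ℝ) T, v ⟨t, ht⟩ = v' ⟨t, ht⟩} := by
    refine (ae_restrict_iff' measurableSet_Ioo).1 ?_
    filter_upwards [h, h'] with t h1 h2 ht
    refine Lp.ext ?_
    filter_upwards [h1 ht, h2 ht] with x h3 h4
    rw [h3, h4]
  exact ContinuousMap.ext fun t => congrFun
    (Continuous.ext_on (dense_of_ae hT hD) v.continuous v'.continuous fun t ht => ht t.2) t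

lemma IsContRep.add (h : IsContRep u v) (h' : IsContRep u' v') : IsContRep (u + u') (v + v') := by
  have h1 := Lp.coeFn_add u u'
  nth_rewrite 1 [volCyl_eq] at h1
  filter_upwards [h, h', Measure.ae_ae_of_ae_prod h1] with t h2 h3 h4 ht
  filter_upwards [h2 ht, h3 ht, h4, Lp.coeFn_add (v ⟨t, ht⟩) (v' ⟨t, ht⟩)] with x h5 h6 h7 h8
  rw [h7, ContinuousMap.add_apply, h8, Pi.add_apply, Pi.add_apply, h5, h6]

lemma IsContRep.smul (c : ℝ) (h : IsContRep u v) : IsContRep (c • u) (c • v) := by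
  have h1 := Lp.coeFn_smul c u
  nth_rewrite 1 [volCyl_eq] at h1
  filter_upwards [h, Measure.ae_ae_of_ae_prod h1] with t h2 h4 ht
  filter_upwards [h2 ht, h4, Lp.coeFn_smul c (v ⟨t, ht⟩)] with x h5 h7 h8
  rw [h7, ContinuousMap.smul_apply, h8, Pi.smul_apply, Pi.smul_apply, h5]

lemma IsContRep.eq_of_eq (h : IsContRep u v) (h' : IsContRep u' v) : u = u' := by
  refine Lp.ext ?_
  have hm : MeasurableSet {z | u z = u' z} :=
    (Lp.stronglyMeasurable u).measurableSet_eq_fun (Lp.stronglyMeasurable u')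
  have h1 : ∀ᵐ z ∂((volTime T).prod (volOn Ω)), u z = u' z := by
    rw [Measure.ae_prod_iff_ae_ae hm]
    filter_upwards [h, h', ae_restrict_mem measurableSet_Ioo] with t h2 h3 ht
    filter_upwards [h2 (Ioo_subset_Icc_self ht), h3 (Ioo_subset_Icc_self ht)] with x h4 h5
    rw [← h4, ← h5]
  rw [← volCyl_eq] at h1
  exact h1

variable {p : ℝ≥0∞} [Fact (1 ≤ p)]

lemma norm_le_normW (u : spaceW Ω m p T) : ‖(u : Lp (Eu m) ∞ (volCyl T Ω))‖ ≤ normW u := by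
  have h1 : 0 ≤ normLpW u := Real.sInf_nonneg <| by
    rintro _ ⟨U, -, rfl⟩
    exact norm_nonneg _
  have h2 : 0 ≤ normTimeDeriv u := Real.sInf_nonneg <| by
    rintro _ ⟨f, g, -, rfl⟩
    exact add_nonneg (norm_nonneg f) (by rw [Lp.norm_def]; exact ENNReal.toReal_nonneg)
  rw [normW]
  linarith

end Representative

end ParabolicW

theorem propositionA2 {d m : ℕ} (p : ENNReal) [Fact (1 ≤ p)] (hp₁ : 1 < p) (hp₂ : p < 2)
    (T : ℝ) (hT : 0 < T) (Ω : TopologicalSpace.Opens (ParabolicW.Eu d))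
    (hΩ : Bornology.IsBounded (Ω : Set (ParabolicW.Eu d))) :
    ∃ J : ParabolicW.spaceW Ω m p T →ₗ[ℝ] ParabolicW.CTimeL2 Ω m T,
      (∀ u : ParabolicW.spaceW Ω m p T, ParabolicW.IsContRep u.1 (J u)) ∧
      Function.Injective J ∧
      ∃ C : ℝ, ∀ u : ParabolicW.spaceW Ω m p T, ‖J u‖ ≤ C * ParabolicW.normW u := by
  have hfin : IsFiniteMeasure (ParabolicW.volOn Ω) :=
    ⟨by rw [Measure.restrict_apply_univ]; exact hΩ.measure_lt_top⟩
  have hex : ∀ u : ParabolicW.spaceW Ω m p T, ∃ v : ParabolicW.CTimeL2 Ω m T,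
      ParabolicW.IsContRep u.1 v ∧
      ‖v‖ ≤ (measureUnivNNReal (ParabolicW.volOn Ω) : ℝ) ^ (2 : ℝ≥0∞).toReal⁻¹ * ‖u.1‖ := by
    rintro ⟨u, ⟨U, hU⟩, f, g, h⟩
    exact ParabolicW.exists_continuous_representative hp₁ hp₂ hT hU h
  choose J hJ hJn using hex
  refine ⟨⟨⟨J, fun u u' => ?_⟩, fun c u => ?_⟩, hJ, fun u u' h => ?_,
    (measureUnivNNReal (ParabolicW.volOn Ω) : ℝ) ^ (2 : ℝ≥0∞).toReal⁻¹, fun u => ?_⟩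
  · exact (hJ (u + u')).unique hT ((hJ u).add (hJ u'))
  · exact (hJ (c • u)).unique hT ((hJ u).smul c)
  · have h1 := hJ u
    rw [show J u = J u' from h] at h1
    exact Subtype.ext (h1.eq_of_eq (hJ u'))
  · exact (hJn u).trans (mul_le_mul_of_nonneg_left (ParabolicW.norm_le_normW u) (by positivity))
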